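/- Let $\Bbbk$ be a field of characteristic zero. A *double multiplicative Poisson vertex algebra* is a unital associative $\Bbbk$-algebra $\mathcal V$ with an automorphism $S$ of infinite order (extended diagonally to $\mathcal V\otimes\mathcal V$) and a linear map $\mathcal V\otimes\mathcal V\to(\mathcal V\otimes\mathcal V)[\lambda^{\pm1}]$, $a\otimes b\mapsto\{\!\{a_\lambda b\}\!\}=\sum_n\{\!\{a,b\}\!\}_n\lambda^n$, such that, for all $a,b,c\in\mathcal V$, 1. $\{\!\{S(a)_\lambda b\}\!\}=\lambda^{-1}\{\!\{a_\lambda b\}\!\}$ and $\{\!\{a_\lambda S(b)\}\!\}=\lambda S(\{\!\{a_\lambda b\}\!\})$; 2. $\{\!\{a_\lambda bc\}\!\}=\{\!\{a_\lambda b\}\!\}(1\otimes c)+(b\otimes1)\{\!\{a_\lambda c\}\!\}$; 3. $\{\!\{ab_\lambda c\}\!\}=\sum_n\big(\{\!\{a,c\}\!\}_n(S^n(b)\otimes1)+(1\otimes S^n(a))\{\!\{b,c\}\!\}_n\big)\lambda^n$; 4. (skewsymmetry) $\{\!\{a_\lambda b\}\!\}=-\sum_n\lambda^{-n}S^{-n}\big(\{\!\{b,a\}\!\}_n^\sigma\big)$,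 where $(x\otimes y)^\sigma=y\otimes x$; 5. (Jacobi identity) $\{\!\{a_\lambda\{\!\{b_\mu c\}\!\}\}\!\}_L-\{\!\{b_\mu\{\!\{a_\lambda c\}\!\}\}\!\}_R-\{\!\{\{\!\{a_\lambda b\}\!\}_{\lambda\mu}c\}\!\}_L=0$, where $\{\!\{a_\lambda x\otimes y\}\!\}_L=\{\!\{a_\lambda x\}\!\}\otimes y$, $\{\!\{a_\lambda x\otimes y\}\!\}_R=x\otimes\{\!\{a_\lambda y\}\!\}$, and $\{\!\{x\otimes y\,{}_\lambda c\}\!\}_L=\sum_n\lambda^n\,p_n'\otimes S^n(y)\otimes p_n''$ with $\{\!\{x,c\}\!\}_n=p_n'\otimes p_n''$ (sum understood). A map satisfying 1–3 is called a double multiplicative $\lambda$-bracket. Let $\mathcal R_2=\Bbbk\langle u_i,v_i\mid i\in\mathbb Z\rangle$ be the free algebra with the automorphism $S(u_i)=u_{i+1}$, $S(v_i)=v_{i+1}$, and write $u=u_0$, $v=v_0$. Let $k\in\mathbb Z$ and $g\in\mathcal R_2\otimes\mathcal R_2$. There is a unique skewsymmetric double multiplicative $\lambda$-bracket on $\mathcal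 R_2$ with $$\{\!\{u_\lambda u\}\!\}=0,\qquad \{\!\{v_\lambda v\}\!\}=0,\qquad \{\!\{u_\lambda v\}\!\}=g\,\lambda^k .$$ With this bracket, $\mathcal R_2$ is a double multiplicative Poisson vertex algebra if and only if, after a translation $u_i\mapsto u_i+\mu$, $v_i\mapsto v_i+\nu$ (all $i\in\mathbb Z$) with some $\mu,\nu\in\Bbbk$, the element $g$ takes one of the following forms; moreover, exactly one of the five forms can be reached from $g$ by translations: (i) $g=a\,1\otimes1$ with $a\in\Bbbk$; (ii) $g=a\,v\otimes v$ with $a\in\Bbbk^\times$; (iii) $g=a\,u_k\otimes u_k$ with $a\in\Bbbk^\times$; (iv) $g=a\,v\otimes v+b\,(v\otimes u_k+u_k\otimes v)+\frac{b^2}{a}\,u_k\otimes u_k$ with $a,b\in\Bbbk^\times$; (v) $g=a\,vu_k\otimes u_kv+b\,(vu_k\otimes1+1\otimes u_kv)+\frac{b^2}{a}\,1\otimes1$ with $a\in\Bbbk^\times$, $b\in\Bbbk$. -/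

import Mathlib

open scoped TensorProduct

noncomputable section

namespace DoubleMPVA

section General

variable {K : Type*} [Field K] {V : Type*} [Ring V] [Algebra K V]

/-- A linear map `a ⊗ b ↦ {{a_λ b}}` with values in Laurent polynomials in `λ` over `V ⊗ V`.
A Laurent polynomial `∑ pₙ λⁿ` is recorded by its finitely supported family of coefficients
`n ↦ pₙ`. -/
abbrev LambdaMap (K : Type*) [Field K] (V : Type*) [Ring V] [Algebra K V] :=
  V →ₗ[K] V →ₗ[K] (ℤ →₀ V ⊗[K] V)

/-- The coefficient of `λⁿ` in `{{a_λ b}}`, as a bilinear map in `a` and `b`. -/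
def LambdaMap.coeff (B : LambdaMap K V) (n : ℤ) : V →ₗ[K] V →ₗ[K] V ⊗[K] V :=
  B.compr₂ (Finsupp.lapply n)

/-- The outer left action `b (a₁ ⊗ a₂) = b a₁ ⊗ a₂`. -/
def outerLeft (b : V) : V ⊗[K] V →ₗ[K] V ⊗[K] V := (LinearMap.mulLeft K b).rTensor V

/-- The outer right action `(a₁ ⊗ a₂) b = a₁ ⊗ a₂ b`. -/
def outerRight (b : V) : V ⊗[K] V →ₗ[K] V ⊗[K] V := (LinearMap.mulRight K b).lTensor V

/-- The inner left action `b ∗₁ (a₁ ⊗ a₂) = a₁ ⊗ b a₂`. -/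
def innerLeft (b : V) : V ⊗[K] V →ₗ[K] V ⊗[K] V := (LinearMap.mulLeft K b).lTensor V

/-- The inner right action `(a₁ ⊗ a₂) ∗₁ b = a₁ b ⊗ a₂`. -/
def innerRight (b : V) : V ⊗[K] V →ₗ[K] V ⊗[K] V := (LinearMap.mulRight K b).rTensor V

/-- The flip `(a ⊗ b)^σ = b ⊗ a`. -/
def flip : V ⊗[K] V →ₗ[K] V ⊗[K] V := (TensorProduct.comm K V V).toLinearMap

/-- The diagonal action `a ⊗ b ↦ S a ⊗ S b` of an algebra endomorphism on `V ⊗ V`. -/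
def diag (S : V →ₐ[K] V) : V ⊗[K] V →ₗ[K] V ⊗[K] V :=
  TensorProduct.map S.toLinearMap S.toLinearMap

/-- The action of the power `Sⁿ` (`n` an integer) on `V ⊗ V`. -/
def diagPow (S : V ≃ₐ[K] V) (n : ℤ) : V ⊗[K] V →ₗ[K] V ⊗[K] V :=
  diag ((S ^ n : V ≃ₐ[K] V) : V →ₐ[K] V)

/-- Double multiplicative `λ`-brackets on `(V, S)`; each identity between Laurent polynomials
is stated as the equality of the coefficients of `λⁿ`, for all `n`. -/
structure IsLambdaBracket (S : V ≃ₐ[K] V) (B : LambdaMap K V) : Prop where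
  /-- `{{S(a)_λ b}} = λ⁻¹ {{a_λ b}}` -/
  sesq_left : ∀ (a b : V) (n : ℤ), B.coeff n (S a) b = B.coeff (n + 1) a b
  /-- `{{a_λ S(b)}} = λ S({{a_λ b}})` -/
  sesq_right : ∀ (a b : V) (n : ℤ),
    B.coeff n a (S b) = diagPow S 1 (B.coeff (n - 1) a b)
  /-- `{{a_λ bc}} = {{a_λ b}} c + b {{a_λ c}}` -/
  leibniz_left : ∀ (a b c : V) (n : ℤ),
    B.coeff n a (b * c) = outerRight c (B.coeff n a b) + outerLeft b (B.coeff n a c)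
  /-- `{{ab_λ c}} = {{a_{λx} c}} ∗₁ (|_{x=S} b) + (|_{x=S} a) ∗₁ {{b_{λx} c}}` -/
  leibniz_right : ∀ (a b c : V) (n : ℤ),
    B.coeff n (a * b) c =
      innerRight ((S ^ n) b) (B.coeff n a c) + innerLeft ((S ^ n) a) (B.coeff n b c)

/-- Skewsymmetry `{{a_λ b}} = - |_{x=S} {{b_{λ⁻¹x⁻¹} a}}^σ`: the coefficient of `λⁿ` on the
right is `- Sⁿ` applied to the flip of the coefficient of `λ⁻ⁿ` in `{{b_λ a}}`. -/
def IsSkew (S : V ≃ₐ[K] V) (B : LambdaMap K V) : Prop :=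
  ∀ (a b : V) (n : ℤ), B.coeff n a b = - diagPow S n (flip (B.coeff (-n) b a))

/-- The coefficient of `λᵐ` in `{{a_λ A}}_L = {{a_λ A'}} ⊗ A''`. -/
def brL (B : LambdaMap K V) (m : ℤ) (a : V) : V ⊗[K] V →ₗ[K] V ⊗[K] (V ⊗[K] V) :=
  (TensorProduct.assoc K V V V).toLinearMap ∘ₗ (B.coeff m a).rTensor V

/-- The coefficient of `λᵐ` in `{{a_λ A}}_R = A' ⊗ {{a_λ A''}}`. -/
def brR (B : LambdaMap K V) (m : ℤ) (a : V) : V ⊗[K] V →ₗ[K] V ⊗[K] (V ⊗[K] V) :=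
  (B.coeff m a).lTensor V

/-- The map `(a₁ ⊗ a₂) ⊗ b ↦ (a₁ ⊗ a₂) ⊗₁ b = a₁ ⊗ b ⊗ a₂`. -/
def insertMiddle : (V ⊗[K] V) ⊗[K] V →ₗ[K] V ⊗[K] (V ⊗[K] V) :=
  (TensorProduct.comm K V V).toLinearMap.lTensor V ∘ₗ (TensorProduct.assoc K V V V).toLinearMap

/-- The coefficient of `λⁿ` in `{{A_λ c}}_L = {{A'_{λx} c}} ⊗₁ (|_{x=S} A'')`. -/
def brArgL (S : V ≃ₐ[K] V) (B : LambdaMap K V) (n : ℤ) (c : V) :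
    V ⊗[K] V →ₗ[K] V ⊗[K] (V ⊗[K] V) :=
  insertMiddle ∘ₗ
    TensorProduct.map ((B.coeff n).flip c) (S ^ n : V ≃ₐ[K] V).toLinearMap

/-- Jacobi identity
`{{a_λ {{b_μ c}}}}_L - {{b_μ {{a_λ c}}}}_R - {{{{a_λ b}}_{λμ} c}}_L = 0`,
stated for the coefficient of `λᵐ μⁿ`. In the last term the inner bracket contributes `λᵖ` and
the outer one `(λμ)^q`, so that `q = n` and `p = m - n`. -/
def IsJacobi (S : V ≃ₐ[K] V) (B : LambdaMap K V) : Prop :=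
  ∀ (a b c : V) (m n : ℤ),
    brL B m a (B.coeff n b c) - brR B n b (B.coeff m a c)
      - brArgL S B n c (B.coeff (m - n) a b) = 0

/-- `(V, S)` with `B` is a double multiplicative Poisson vertex algebra. -/
structure IsDoubleMPVA (S : V ≃ₐ[K] V) (B : LambdaMap K V) : Prop where
  infinite_order : ¬ IsOfFinOrder S
  bracket : IsLambdaBracket S B
  skew : IsSkew S B
  jacobi : IsJacobi S B

end General

section FreeDifference

variable (K : Type*) [Field K]

/-- Non-commutative difference polynomials in two variables: the free associative algebra on
`u_n = (0, n)` and `v_n = (1, n)`, `n ∈ ℤ`. -/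
abbrev R2 := FreeAlgebra K (Fin 2 × ℤ)

/-- The generator `u_n`; the variable `u` is `u_0`. -/
def u (n : ℤ) : R2 K := FreeAlgebra.ι K (0, n)

/-- The generator `v_n`; the variable `v` is `v_0`. -/
def v (n : ℤ) : R2 K := FreeAlgebra.ι K (1, n)

/-- The endomorphism of `R2` shifting the index of every generator by `r`. -/
def shiftHom (r : ℤ) : R2 K →ₐ[K] R2 K :=
  FreeAlgebra.lift K fun p => FreeAlgebra.ι K (p.1, p.2 + r)

/-- The automorphism `S` with `S(u_n) = u_{n+1}` and `S(v_n) = v_{n+1}`. -/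
def shift : R2 K ≃ₐ[K] R2 K :=
  AlgEquiv.ofAlgHom (shiftHom K 1) (shiftHom K (-1))
    (by ext p; simp [shiftHom]) (by ext p; simp [shiftHom])

variable {K}

/-- The translation `u_n ↦ u_n + μ`, `v_n ↦ v_n + ν` (for all `n`) of `R2`; it is the
algebra endomorphism commuting with `S` with `u ↦ u + μ` and `v ↦ v + ν`. -/
def translation (μ ν : K) : R2 K →ₐ[K] R2 K :=
  FreeAlgebra.lift K fun p => FreeAlgebra.ι K p + algebraMap K (R2 K) (![μ, ν] p.1)

/-- The five normal forms of `g`, numbered from `0` to `4`. -/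
def normalForm (k : ℤ) (g : R2 K ⊗[K] R2 K) : Fin 5 → Prop :=
  ![ ∃ a : K, g = a • (1 ⊗ₜ[K] 1),
     ∃ a : K, a ≠ 0 ∧ g = a • (v K 0 ⊗ₜ[K] v K 0),
     ∃ a : K, a ≠ 0 ∧ g = a • (u K k ⊗ₜ[K] u K k),
     ∃ a b : K, a ≠ 0 ∧ b ≠ 0 ∧
      g = a • (v K 0 ⊗ₜ[K] v K 0) + b • (v K 0 ⊗ₜ[K] u K k + u K k ⊗ₜ[K] v K 0)
        + (b ^ 2 / a) • (u K k ⊗ₜ[K] u K k),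
     ∃ a b : K, a ≠ 0 ∧
      g = a • ((v K 0 * u K k) ⊗ₜ[K] (u K k * v K 0))
        + b • ((v K 0 * u K k) ⊗ₜ[K] 1 + 1 ⊗ₜ[K] (u K k * v K 0))
        + (b ^ 2 / a) • (1 ⊗ₜ[K] 1) ]

/-- `B` is a skewsymmetric double multiplicative `λ`-bracket on `R2` with
`{{u_λ u}} = 0`, `{{v_λ v}} = 0` and `{{u_λ v}} = g λᵏ`. -/
structure IsMonomialBracket (k : ℤ) (g : R2 K ⊗[K] R2 K) (B : LambdaMap K (R2 K)) : Prop where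
  bracket : IsLambdaBracket (shift K) B
  skew : IsSkew (shift K) B
  uu : B (u K 0) (u K 0) = 0
  vv : B (v K 0) (v K 0) = 0
  uv : B (u K 0) (v K 0) = Finsupp.single k g

end FreeDifference

end DoubleMPVA

end

/-! Sesquilinearity makes the coefficient of `λⁿ` in a λ-bracket equal to `P (Sⁿ a) b`, where `P` is
the coefficient at `n = 0`. A λ-bracket is therefore an `S`-equivariant double bracket `P` with a
finiteness condition, and its Jacobi identity is the ordinary one for `P` (`isJacobi_iff`). On a
free algebra a double bracket can be prescribed arbitrarily on generators, and this determines it;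
hence existence and uniqueness. For a skewsymmetric `P` the Jacobiator is a derivation in its last
argument (`jacobiator_leibniz`) and is compatible with cyclic rotation (`jacobiator_cyclic`), so it
suffices to test generators. Up to rotation only the triples `(u, u, v)` and `(v, v, u)` matter.

On `(u_i, u_i', v_j)` the identity compares the derivation `{{u_i, ·}}` on the left factor of a
shift of `g` with `{{u_i', ·}}` on the right factor, a term being absent when the bracket producing
it vanishes. The derivation `{{u_i, ·}}` is nonzero only on the letter `v_{i-k}`. Leading terms
cannot cancel in a free algebra (`exists_split_sum_ne_zero`), so triples with a single surviving
term force `g` to involve only the letters `y = v_0` and `x = u_k`. What is left is a quadratic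
equation, `SplitEquation`, for `g` in `y` and for the flip of `g` in `x`. Comparing degrees in it
shows that each letter occurs at most once in each tensor factor; the words `xy` on the left and
`yx` on the right are then excluded because their coefficients square to zero. The remaining
relations say that the matrix of coefficients has rank at most one (`forms_of_splitEquation`): `g =
a w ⊗ w` with `w` affine, or `g = a (yx + sy + tx + r) ⊗ (xy + sy + tx + r)`.

Conversely both shapes satisfy the Jacobi identity, by the criterion `jacobiator_eq_zero_of_pure`.
Translations remove the constant or linear terms, and three coefficients of `g` tell the five normal
forms apart. -/

open scoped TensorProduct

noncomputable section

namespace DoubleMPVA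

/-! ### Derivations of a free algebra into a bimodule -/

section Derivation

variable {K : Type*} [Field K] {X : Type*} {M : Type*} [AddCommGroup M] [Module K M]

/-- A derivation of a free algebra vanishes as soon as it vanishes on the generators. -/
theorem eq_zero_of_leibniz (L R : FreeAlgebra K X → M →ₗ[K] M)
    (hL : L 1 = LinearMap.id) (hR : R 1 = LinearMap.id) (D : FreeAlgebra K X →ₗ[K] M)
    (hD : ∀ a b, D (a * b) = R b (D a) + L a (D b))
    (h : ∀ x, D (FreeAlgebra.ι K x) = 0) (a : FreeAlgebra K X) : D a = 0 := by
  have h1 : D 1 = 0 := by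
    have := hD 1 1
    rw [hL, hR] at this
    simpa using this
  induction a using FreeAlgebra.induction with
  | grade0 r => rw [Algebra.algebraMap_eq_smul_one, map_smul, h1, smul_zero]
  | grade1 x => exact h x
  | mul a b ha hb => rw [hD, ha, hb, map_zero, map_zero, add_zero]
  | add a b ha hb => rw [map_add, ha, hb, add_zero]

theorem eq_of_leibniz (L R : FreeAlgebra K X → M →ₗ[K] M)
    (hL : L 1 = LinearMap.id) (hR : R 1 = LinearMap.id) (D E : FreeAlgebra K X →ₗ[K] M)
    (hD : ∀ a b, D (a * b) = R b (D a) + L a (D b))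
    (hE : ∀ a b, E (a * b) = R b (E a) + L a (E b))
    (h : ∀ x, D (FreeAlgebra.ι K x) = E (FreeAlgebra.ι K x)) : D = E := by
  ext a
  refine sub_eq_zero.1 (eq_zero_of_leibniz L R hL hR (D - E) (fun a b => ?_) (fun x => ?_) a)
  · simp only [LinearMap.sub_apply, hD, hE, map_sub]; abel
  · rw [LinearMap.sub_apply, h, sub_self]

/-- Derivations of a free algebra with values in a bimodule exist with arbitrary values on the
generators. The bimodule is given by its left action `L` and its right action `R`. -/
theorem exists_leibniz (L : FreeAlgebra K X →ₐ[K] Module.End K M)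
    (R : FreeAlgebra K X →ₗ[K] Module.End K M) (hR1 : R 1 = 1)
    (hRmul : ∀ a b, R (a * b) = R b * R a) (hLR : ∀ a b m, L a (R b m) = R b (L a m))
    (φ : X → M) :
    ∃ D : FreeAlgebra K X →ₗ[K] M, (∀ x, D (FreeAlgebra.ι K x) = φ x) ∧
      ∀ a b, D (a * b) = R b (D a) + L a (D b) := by
  -- A derivation is the off-diagonal entry of a triangular representation: `Φ a` sends `(y, m)` to
  -- `(a y, R y (D a) + L a m)`. Freeness provides `Φ` from its values on letters, and `D a` is read
  -- off at `(1, 0)`.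
  let Φ : FreeAlgebra K X →ₐ[K] Module.End K (FreeAlgebra K X × M) := FreeAlgebra.lift K fun x =>
    LinearMap.prod (LinearMap.mulLeft K (FreeAlgebra.ι K x) ∘ₗ LinearMap.fst K (FreeAlgebra K X) M)
      (R.flip (φ x) ∘ₗ LinearMap.fst K (FreeAlgebra K X) M + L (FreeAlgebra.ι K x) ∘ₗ LinearMap.snd K (FreeAlgebra K X) M)
  have hΦ : ∀ x, Φ (FreeAlgebra.ι K x) =
      LinearMap.prod (LinearMap.mulLeft K (FreeAlgebra.ι K x) ∘ₗ LinearMap.fst K _ M)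
        (R.flip (φ x) ∘ₗ LinearMap.fst K _ M + L (FreeAlgebra.ι K x) ∘ₗ LinearMap.snd K _ M) :=
    fun x => FreeAlgebra.lift_ι_apply _ _
  let D : FreeAlgebra K X →ₗ[K] M := LinearMap.snd K (FreeAlgebra K X) M ∘ₗ LinearMap.applyₗ ((1, 0) : FreeAlgebra K X × M) ∘ₗ Φ.toLinearMap
  have hDdef : ∀ a, D a = (Φ a (1, 0)).2 := fun a => rfl
  have key : ∀ a y m, Φ a (y, m) = (a * y, R y (D a) + L a m) := by
    intro a
    induction a using FreeAlgebra.induction with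
    | grade0 r => intro y m; simp [hDdef, Algebra.algebraMap_eq_smul_one]
    | grade1 x => intro y m; simp [hDdef, hΦ, hR1]
    | mul a b ha hb =>
      intro y m
      rw [hDdef, map_mul, Module.End.mul_apply, Module.End.mul_apply, hb, hb, ha, ha]
      simp only [Prod.mk.injEq, mul_assoc, true_and, map_add, map_mul, Module.End.mul_apply,
        hLR, hRmul, hR1, Module.End.one_apply, mul_one, map_zero, add_zero]
      abel
    | add a b ha hb =>
      intro y m
      rw [map_add, LinearMap.add_apply, ha, hb, map_add, map_add, map_add, LinearMap.add_apply]
      simp only [Prod.mk_add_mk, add_mul, Prod.mk.injEq, true_and]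
      abel
  refine ⟨D, fun x => by simp [hDdef, hΦ, hR1], fun a b => ?_⟩
  rw [hDdef, map_mul, Module.End.mul_apply, key b, key a]
  simp [hR1]

end Derivation

/-! ### Bimodule actions on the tensor square; double brackets -/

section DoubleBracket

variable {K : Type*} [Field K] {V : Type*} [Ring V] [Algebra K V]

@[simp] theorem outerLeft_tmul (b x y : V) :
    outerLeft b (x ⊗ₜ[K] y) = (b * x) ⊗ₜ[K] y := rfl
@[simp] theorem outerRight_tmul (b x y : V) :
    outerRight b (x ⊗ₜ[K] y) = x ⊗ₜ[K] (y * b) := rfl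
@[simp] theorem innerLeft_tmul (b x y : V) :
    innerLeft b (x ⊗ₜ[K] y) = x ⊗ₜ[K] (b * y) := rfl
@[simp] theorem innerRight_tmul (b x y : V) :
    innerRight b (x ⊗ₜ[K] y) = (x * b) ⊗ₜ[K] y := rfl
@[simp] theorem flip_tmul (x y : V) : flip (x ⊗ₜ[K] y) = y ⊗ₜ[K] x := rfl
@[simp] theorem diag_tmul (S : V →ₐ[K] V) (x y : V) :
    diag S (x ⊗ₜ[K] y) = S x ⊗ₜ[K] S y := rfl

@[simp] theorem outerLeft_one : outerLeft (K := K) (1 : V) = LinearMap.id := by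
  ext; simp
@[simp] theorem outerRight_one : outerRight (K := K) (1 : V) = LinearMap.id := by
  ext; simp
@[simp] theorem innerLeft_one : innerLeft (K := K) (1 : V) = LinearMap.id := by
  ext; simp
@[simp] theorem innerRight_one : innerRight (K := K) (1 : V) = LinearMap.id := by
  ext; simp

theorem flip_outerLeft (b : V) (t : V ⊗[K] V) : flip (outerLeft b t) = innerLeft b (flip t) := by
  induction t using TensorProduct.induction_on <;> simp_all
theorem flip_outerRight (b : V) (t : V ⊗[K] V) :
    flip (outerRight b t) = innerRight b (flip t) := by
  induction t using TensorProduct.induction_on <;> simp_all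
theorem flip_innerLeft (b : V) (t : V ⊗[K] V) : flip (innerLeft b t) = outerLeft b (flip t) := by
  induction t using TensorProduct.induction_on <;> simp_all
theorem flip_innerRight (b : V) (t : V ⊗[K] V) :
    flip (innerRight b t) = outerRight b (flip t) := by
  induction t using TensorProduct.induction_on <;> simp_all
theorem flip_flip (t : V ⊗[K] V) : flip (flip t) = t := by
  induction t using TensorProduct.induction_on <;> simp_all
theorem flip_diag (S : V →ₐ[K] V) (t : V ⊗[K] V) : flip (diag S t) = diag S (flip t) := by
  induction t using TensorProduct.induction_on <;> simp_all

theorem diag_outerLeft (S : V →ₐ[K] V) (b : V) (t : V ⊗[K] V) :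
    diag S (outerLeft b t) = outerLeft (S b) (diag S t) := by
  induction t using TensorProduct.induction_on <;> simp_all
theorem diag_outerRight (S : V →ₐ[K] V) (b : V) (t : V ⊗[K] V) :
    diag S (outerRight b t) = outerRight (S b) (diag S t) := by
  induction t using TensorProduct.induction_on <;> simp_all
theorem diag_innerLeft (S : V →ₐ[K] V) (b : V) (t : V ⊗[K] V) :
    diag S (innerLeft b t) = innerLeft (S b) (diag S t) := by
  induction t using TensorProduct.induction_on <;> simp_all
theorem diag_innerRight (S : V →ₐ[K] V) (b : V) (t : V ⊗[K] V) :
    diag S (innerRight b t) = innerRight (S b) (diag S t) := by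
  induction t using TensorProduct.induction_on <;> simp_all

/-- Double brackets (not necessarily skewsymmetric) on an associative algebra. -/
structure IsDoubleBracket (P : V →ₗ[K] V →ₗ[K] V ⊗[K] V) : Prop where
  left : ∀ a b c, P a (b * c) = outerRight c (P a b) + outerLeft b (P a c)
  right : ∀ a b c, P (a * b) c = innerRight b (P a c) + innerLeft a (P b c)

end DoubleBracket

/-! ### Double brackets on a free algebra -/

section FreeDoubleBracket

variable {K : Type*} [Field K] {X : Type*}

local notation "V" => FreeAlgebra K X

theorem IsDoubleBracket.ext_of_ι {P Q : V →ₗ[K] V →ₗ[K] V ⊗[K] V} (hP : IsDoubleBracket P)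
    (hQ : IsDoubleBracket Q)
    (h : ∀ x y, P (FreeAlgebra.ι K x) (FreeAlgebra.ι K y) =
      Q (FreeAlgebra.ι K x) (FreeAlgebra.ι K y)) : P = Q := by
  have h1 : ∀ x, P (FreeAlgebra.ι K x) = Q (FreeAlgebra.ι K x) := fun x =>
    eq_of_leibniz outerLeft outerRight outerLeft_one outerRight_one _ _
      (hP.left _) (hQ.left _) (h x)
  ext a b
  refine DFunLike.congr_fun (eq_of_leibniz innerLeft innerRight innerLeft_one innerRight_one
    (P.flip b) (Q.flip b) (fun x y => hP.right x y b) (fun x y => hQ.right x y b) ?_) a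
  intro x
  simp [h1]

/-- Derivations are extended twice: each `P x ·`, for a letter `x`, for the outer actions, and then
`a ↦ P a ·`, with values in a space of linear maps, for the inner actions. -/
theorem exists_isDoubleBracket (φ : X → X → V ⊗[K] V) :
    ∃ P : V →ₗ[K] V →ₗ[K] V ⊗[K] V, IsDoubleBracket P ∧
      ∀ x y, P (FreeAlgebra.ι K x) (FreeAlgebra.ι K y) = φ x y := by
  have hD : ∀ x, ∃ D : V →ₗ[K] V ⊗[K] V, (∀ y, D (FreeAlgebra.ι K y) = φ x y) ∧
      ∀ a b, D (a * b) = outerRight b (D a) + outerLeft a (D b) := fun x => by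
    refine exists_leibniz
      (AlgHom.ofLinearMap (LinearMap.rTensorHom V ∘ₗ LinearMap.mul K V) ?_ ?_)
      (LinearMap.lTensorHom V ∘ₗ (LinearMap.mul K V).flip) ?_ ?_ ?_ (φ x)
    · ext; simp
    · intro a b; ext; simp [mul_assoc]
    · ext; simp
    · intro a b; ext; simp [mul_assoc]
    · intro a b m
      induction m using TensorProduct.induction_on <;> simp_all
  choose D hDι hDmul using hD
  obtain ⟨P, hPι, hPmul⟩ := exists_leibniz (M := V →ₗ[K] V ⊗[K] V)
    (AlgHom.ofLinearMap (LinearMap.llcomp K V (V ⊗[K] V) (V ⊗[K] V) ∘ₗ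
      LinearMap.lTensorHom V ∘ₗ LinearMap.mul K V)
      (by ext f c; exact DFunLike.congr_fun innerLeft_one (f c)) (by
        intro a b; refine LinearMap.ext fun f => LinearMap.ext fun c => ?_
        simp only [LinearMap.comp_apply, Module.End.mul_apply, LinearMap.llcomp_apply]
        generalize f c = t
        induction t using TensorProduct.induction_on <;> simp_all [mul_assoc]))
    (LinearMap.llcomp K V (V ⊗[K] V) (V ⊗[K] V) ∘ₗ
      LinearMap.rTensorHom V ∘ₗ (LinearMap.mul K V).flip)
      (by ext f c; exact DFunLike.congr_fun innerRight_one (f c)) (by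
        intro a b; refine LinearMap.ext fun f => LinearMap.ext fun c => ?_
        simp only [LinearMap.comp_apply, Module.End.mul_apply, LinearMap.llcomp_apply]
        generalize f c = t
        induction t using TensorProduct.induction_on <;> simp_all [mul_assoc])
    (by
        intro a b f; refine LinearMap.ext fun c => ?_
        simp only [LinearMap.comp_apply, LinearMap.llcomp_apply, AlgHom.ofLinearMap_apply]
        generalize f c = t
        induction t using TensorProduct.induction_on <;> simp_all) D
  have hright : ∀ a b c, P (a * b) c = innerRight b (P a c) + innerLeft a (P b c) :=
    fun a b c => by rw [hPmul]; rfl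
  refine ⟨P, ⟨fun a b c => ?_, hright⟩, fun x y => by rw [hPι, hDι]⟩
  -- The outer Leibniz rule is so far known only for letters in the first argument. Both of its
  -- sides are inner derivations in that argument, because inner and outer actions commute.
  refine DFunLike.congr_fun (eq_of_leibniz innerLeft innerRight innerLeft_one innerRight_one
    (P.flip (b * c)) (outerRight c ∘ₗ P.flip b + outerLeft b ∘ₗ P.flip c) ?_ ?_ ?_) a
  · exact fun x y => hright x y _
  · intro x y
    simp only [LinearMap.add_apply, LinearMap.comp_apply, LinearMap.flip_apply, hright, map_add]
    have e1 : ∀ t : V ⊗[K] V, outerRight c (innerRight y t) = innerRight y (outerRight c t) := by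
      intro t; induction t using TensorProduct.induction_on <;> simp_all
    have e2 : ∀ t : V ⊗[K] V, outerRight c (innerLeft x t) = innerLeft x (outerRight c t) := by
      intro t; induction t using TensorProduct.induction_on <;> simp_all [mul_assoc]
    have e3 : ∀ t : V ⊗[K] V, outerLeft b (innerRight y t) = innerRight y (outerLeft b t) := by
      intro t; induction t using TensorProduct.induction_on <;> simp_all [mul_assoc]
    have e4 : ∀ t : V ⊗[K] V, outerLeft b (innerLeft x t) = innerLeft x (outerLeft b t) := by
      intro t; induction t using TensorProduct.induction_on <;> simp_all
    rw [e1, e2, e3, e4]; abel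
  · intro x
    simp [hPι, hDmul]

end FreeDoubleBracket

/-! ### The Jacobiator: cyclic symmetry and Leibniz rule -/

section Jacobiator

variable {K : Type*} [Field K] {V : Type*} [Ring V] [Algebra K V]

/-- The map `(a ⊗ b) ⊗ c ↦ a ⊗ b ⊗ c`. -/
abbrev assocMap : (V ⊗[K] V) ⊗[K] V →ₗ[K] V ⊗[K] (V ⊗[K] V) :=
  (TensorProduct.assoc K V V V).toLinearMap

/-- The Jacobiator of a double bracket, as a linear map in its last argument. -/
def jacobiator (P : V →ₗ[K] V →ₗ[K] V ⊗[K] V) (a b : V) : V →ₗ[K] V ⊗[K] (V ⊗[K] V) :=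
  assocMap ∘ₗ (P a).rTensor V ∘ₗ P b - (P b).lTensor V ∘ₗ P a
    - insertMiddle ∘ₗ LinearMap.applyₗ (P a b) ∘ₗ LinearMap.rTensorHom V ∘ₗ P.flip

theorem jacobiator_apply (P : V →ₗ[K] V →ₗ[K] V ⊗[K] V) (a b c : V) :
    jacobiator P a b c = assocMap ((P a).rTensor V (P b c)) - (P b).lTensor V (P a c)
      - insertMiddle ((P.flip c).rTensor V (P a b)) := rfl

/-- The cyclic permutation `a ⊗ b ⊗ c ↦ b ⊗ c ⊗ a`. -/
def rot : V ⊗[K] (V ⊗[K] V) →ₗ[K] V ⊗[K] (V ⊗[K] V) :=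
  assocMap ∘ₗ (TensorProduct.comm K V (V ⊗[K] V)).toLinearMap

theorem rot_tmul (a b c : V) : rot (a ⊗ₜ[K] (b ⊗ₜ[K] c)) = b ⊗ₜ[K] (c ⊗ₜ[K] a) := rfl

theorem rot_rot_rot (t : V ⊗[K] (V ⊗[K] V)) : rot (rot (rot t)) = t := by
  have : rot ∘ₗ rot ∘ₗ rot = (LinearMap.id : V ⊗[K] (V ⊗[K] V) →ₗ[K] _) := by
    ext; simp [rot_tmul]
  exact DFunLike.congr_fun this t

/-- Skewsymmetry turns the second and third terms into rotations of the first with cyclically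
permuted arguments, and absorbs their signs. Invariance under simultaneous rotation of arguments and
tensor factors is then visible. -/
theorem jacobiator_eq_sum_rot {P : V →ₗ[K] V →ₗ[K] V ⊗[K] V}
    (hskew : ∀ a b, P a b = - flip (P b a)) (a b c : V) :
    jacobiator P a b c = assocMap ((P a).rTensor V (P b c))
      + rot (rot (assocMap ((P b).rTensor V (P c a))))
      + rot (assocMap ((P c).rTensor V (P a b))) := by
  have h2 : (P b).lTensor V (P a c) = - rot (rot (assocMap ((P b).rTensor V (P c a)))) := by
    rw [hskew a c, map_neg, neg_inj]
    induction P c a using TensorProduct.induction_on with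
    | zero => simp
    | add x y hx hy => simp only [map_add, hx, hy]
    | tmul x y =>
      rw [flip_tmul, LinearMap.lTensor_tmul, LinearMap.rTensor_tmul]
      induction P b x using TensorProduct.induction_on with
      | zero => simp
      | add x y hx hy => simp only [map_add, TensorProduct.add_tmul, TensorProduct.tmul_add, hx, hy]
      | tmul p q => rfl
  have h3 : insertMiddle ((P.flip c).rTensor V (P a b)) =
      - rot (assocMap ((P c).rTensor V (P a b))) := by
    induction P a b using TensorProduct.induction_on with
    | zero => simp
    | add x y hx hy => simp only [map_add, hx, hy, neg_add]
    | tmul x y =>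
      rw [LinearMap.rTensor_tmul, LinearMap.rTensor_tmul, LinearMap.flip_apply, hskew x c,
        TensorProduct.neg_tmul, map_neg, neg_inj]
      induction P c x using TensorProduct.induction_on with
      | zero => simp
      | add x y hx hy => simp only [map_add, TensorProduct.add_tmul, hx, hy]
      | tmul p q => rfl
  rw [jacobiator_apply, h2, h3]
  abel

theorem jacobiator_cyclic {P : V →ₗ[K] V →ₗ[K] V ⊗[K] V}
    (hskew : ∀ a b, P a b = - flip (P b a)) (a b c : V) :
    jacobiator P a b c = rot (rot (jacobiator P b c a)) := by
  rw [jacobiator_eq_sum_rot hskew, jacobiator_eq_sum_rot hskew b c a]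
  simp only [map_add, rot_rot_rot]
  abel

/-- The Jacobiator thus becomes a derivation in its last argument, for the outer bimodule structure
on the triple tensor power, so it is controlled by its values on letters. Mixed terms arise only
where `c * d` is differentiated twice, by `a` and by `b`, which does not happen in the third
summand. -/
theorem jacobiator_leibniz {P : V →ₗ[K] V →ₗ[K] V ⊗[K] V} (hP : IsDoubleBracket P)
    (a b c d : V) :
    jacobiator P a b (c * d) =
      (outerRight d).lTensor V (jacobiator P a b c)
        + (LinearMap.mulLeft K c).rTensor (V ⊗[K] V) (jacobiator P a b d) := by
  /- the mixed terms of the first two summands cancel -/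
  let Z : V ⊗[K] (V ⊗[K] V) := (LinearMap.lTensor V (LinearMap.rTensor V (LinearMap.mul' K V)) ∘ₗ
    LinearMap.lTensor V (TensorProduct.assoc K V V V).symm.toLinearMap ∘ₗ
    (TensorProduct.assoc K V V (V ⊗[K] V)).toLinearMap) (P a c ⊗ₜ[K] P b d)
  have h1 : assocMap ((P a).rTensor V (P b (c * d))) =
      (outerRight d).lTensor V (assocMap ((P a).rTensor V (P b c)))
        + (LinearMap.mulLeft K c).rTensor (V ⊗[K] V) (assocMap ((P a).rTensor V (P b d)))
        + Z := by
    have e1 : ∀ t : V ⊗[K] V, assocMap ((P a).rTensor V (outerRight d t)) =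
        (outerRight d).lTensor V (assocMap ((P a).rTensor V t)) := by
      intro t
      induction t using TensorProduct.induction_on with
      | zero => simp
      | add x y hx hy => simp only [map_add, hx, hy]
      | tmul x y =>
        rw [outerRight_tmul, LinearMap.rTensor_tmul, LinearMap.rTensor_tmul]
        induction P a x using TensorProduct.induction_on with
        | zero => simp
        | add x y hx hy => simp only [map_add, TensorProduct.add_tmul, hx, hy]
        | tmul p q => rfl
    have e2 : assocMap ((P a).rTensor V (outerLeft c (P b d))) =
        (LinearMap.mulLeft K c).rTensor (V ⊗[K] V) (assocMap ((P a).rTensor V (P b d))) + Z := by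
      simp only [Z]
      induction P b d using TensorProduct.induction_on with
      | zero => simp
      | add x y hx hy =>
        simp only [map_add, TensorProduct.tmul_add, hx, hy]; abel
      | tmul x y =>
        rw [outerLeft_tmul, LinearMap.rTensor_tmul, LinearMap.rTensor_tmul, hP.left,
          TensorProduct.add_tmul, map_add, add_comm]
        congr 1
        · induction P a x using TensorProduct.induction_on with
          | zero => simp
          | add x y hx hy => simp only [map_add, TensorProduct.add_tmul, hx, hy]
          | tmul p q => rfl
        · induction P a c using TensorProduct.induction_on with
          | zero => simp
          | add x y hx hy => simp only [map_add, TensorProduct.add_tmul, hx, hy]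
          | tmul p q => rfl
    rw [hP.left, map_add, map_add, e1, e2, add_assoc]
  have h2 : (P b).lTensor V (P a (c * d)) =
      (outerRight d).lTensor V ((P b).lTensor V (P a c))
        + (LinearMap.mulLeft K c).rTensor (V ⊗[K] V) ((P b).lTensor V (P a d)) + Z := by
    have e1 : ∀ t : V ⊗[K] V, (P b).lTensor V (outerLeft c t) =
        (LinearMap.mulLeft K c).rTensor (V ⊗[K] V) ((P b).lTensor V t) := by
      intro t
      induction t using TensorProduct.induction_on with
      | zero => simp
      | add x y hx hy => simp only [map_add, hx, hy]
      | tmul x y => rfl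
    have e2 : (P b).lTensor V (outerRight d (P a c)) =
        (outerRight d).lTensor V ((P b).lTensor V (P a c)) + Z := by
      simp only [Z]
      induction P a c using TensorProduct.induction_on with
      | zero => simp
      | add x y hx hy =>
        simp only [map_add, TensorProduct.add_tmul, hx, hy]; abel
      | tmul x y =>
        rw [outerRight_tmul, LinearMap.lTensor_tmul, LinearMap.lTensor_tmul, hP.left,
          TensorProduct.tmul_add]
        congr 1
        induction P b d using TensorProduct.induction_on with
        | zero => simp
        | add x y hx hy => simp only [map_add, TensorProduct.tmul_add, hx, hy]
        | tmul p q => rfl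
    rw [hP.left, map_add, e1, e2]; abel
  have h3 : insertMiddle ((P.flip (c * d)).rTensor V (P a b)) =
      (outerRight d).lTensor V (insertMiddle ((P.flip c).rTensor V (P a b)))
        + (LinearMap.mulLeft K c).rTensor (V ⊗[K] V)
          (insertMiddle ((P.flip d).rTensor V (P a b))) := by
    induction P a b using TensorProduct.induction_on with
    | zero => simp
    | add x y hx hy => simp only [map_add, hx, hy]; abel
    | tmul x y =>
      simp only [LinearMap.rTensor_tmul, LinearMap.flip_apply, hP.left, TensorProduct.add_tmul,
        map_add]
      congr 1
      · induction P x c using TensorProduct.induction_on with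
        | zero => simp
        | add x y hx hy => simp only [map_add, TensorProduct.add_tmul, hx, hy]
        | tmul p q => rfl
      · induction P x d using TensorProduct.induction_on with
        | zero => simp
        | add x y hx hy => simp only [map_add, TensorProduct.add_tmul, hx, hy]
        | tmul p q => rfl
  rw [jacobiator_apply, jacobiator_apply, jacobiator_apply, h1, h2, h3]
  simp only [map_sub]
  abel

end Jacobiator

/-! ### Reduction of the Jacobi identity to generators -/

section Free

variable {K : Type*} [Field K] {X : Type*}

/-- The Jacobi identity for a skewsymmetric double bracket on a free algebra can be checked on
the generators. -/
theorem jacobiator_eq_zero_of_ι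
    {P : FreeAlgebra K X →ₗ[K] FreeAlgebra K X →ₗ[K] FreeAlgebra K X ⊗[K] FreeAlgebra K X}
    (hP : IsDoubleBracket P) (hskew : ∀ a b, P a b = - flip (P b a))
    (h : ∀ x y z, jacobiator P (FreeAlgebra.ι K x) (FreeAlgebra.ι K y) (FreeAlgebra.ι K z) = 0)
    (a b c : FreeAlgebra K X) : jacobiator P a b c = 0 := by
  have ext_last : ∀ a b, (∀ z, jacobiator P a b (FreeAlgebra.ι K z) = 0) →
      ∀ c, jacobiator P a b c = 0 := fun a b h c =>
    eq_zero_of_leibniz (fun c => (LinearMap.mulLeft K c).rTensor _)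
      (fun d => (outerRight d).lTensor _) (by ext; simp) (by simp)
      _ (jacobiator_leibniz hP a b) h c
  -- The Leibniz rule handles only the last argument; rotations bring each of the others into that
  -- position.
  have cyc : ∀ a b c, jacobiator P b c a = 0 → jacobiator P a b c = 0 := fun a b c h => by
    rw [jacobiator_cyclic hskew, h, map_zero, map_zero]
  have h1 : ∀ x y c, jacobiator P (FreeAlgebra.ι K x) (FreeAlgebra.ι K y) c = 0 :=
    fun x y => ext_last _ _ (h x y)
  have h2 : ∀ x b c, jacobiator P (FreeAlgebra.ι K x) b c = 0 :=
    fun x b => ext_last _ _ fun z => cyc _ _ _ (cyc _ _ _ (h1 z x b))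
  exact ext_last a b (fun z => cyc _ _ _ (cyc _ _ _ (h2 z a b))) c

end Free

/-! ### λ-brackets as equivariant double brackets -/

section LambdaBracket

variable {K : Type*} [Field K] {V : Type*} [Ring V] [Algebra K V]

@[simp] theorem diagPow_tmul (S : V ≃ₐ[K] V) (n : ℤ) (x y : V) :
    diagPow S n (x ⊗ₜ[K] y) = (S ^ n) x ⊗ₜ[K] (S ^ n) y := rfl

theorem diagPow_zero (S : V ≃ₐ[K] V) (t : V ⊗[K] V) : diagPow S 0 t = t := by
  induction t using TensorProduct.induction_on <;> simp_all

theorem diagPow_diagPow (S : V ≃ₐ[K] V) (m n : ℤ) (t : V ⊗[K] V) :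
    diagPow S m (diagPow S n t) = diagPow S (m + n) t := by
  induction t using TensorProduct.induction_on <;> simp_all [zpow_add]

theorem flip_diagPow (S : V ≃ₐ[K] V) (n : ℤ) (t : V ⊗[K] V) :
    flip (diagPow S n t) = diagPow S n (flip t) :=
  flip_diag _ t

variable {S : V ≃ₐ[K] V} {B : LambdaMap K V}

theorem IsLambdaBracket.coeff_zpow (h : IsLambdaBracket S B) (m n : ℤ) (a b : V) :
    B.coeff n ((S ^ m) a) b = B.coeff (n + m) a b := by
  induction m using Int.induction_on generalizing n with
  | zero => simp
  | succ m ih =>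
    have : (S ^ ((m : ℤ) + 1)) a = S ((S ^ (m : ℤ)) a) := by
      rw [add_comm, zpow_one_add, AlgEquiv.mul_apply]
    rw [this, h.sesq_left, ih, show n + 1 + (m : ℤ) = n + (m + 1) by ring]
  | pred m ih =>
    have : S ((S ^ (-(m : ℤ) - 1)) a) = (S ^ (-(m : ℤ))) a := by
      rw [← AlgEquiv.mul_apply, ← zpow_one_add]; congr 2; ring
    have h1 := h.sesq_left ((S ^ (-(m : ℤ) - 1)) a) b (n - 1)
    rw [this, ih, sub_add_cancel] at h1
    rw [← h1, show n - 1 + -(m : ℤ) = n + (-m - 1) by ring]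

theorem IsLambdaBracket.coeff_eq (h : IsLambdaBracket S B) (n : ℤ) (a : V) :
    B.coeff n a = B.coeff 0 ((S ^ n) a) := by
  ext b
  rw [h.coeff_zpow, zero_add]

theorem IsLambdaBracket.isDoubleBracket (h : IsLambdaBracket S B) :
    IsDoubleBracket (B.coeff 0) :=
  ⟨fun a b c => h.leibniz_left a b c 0, fun a b c => h.leibniz_right a b c 0⟩

theorem equivariant_zpow {P : V →ₗ[K] V →ₗ[K] V ⊗[K] V}
    (hS : ∀ a b, P (S a) (S b) = diagPow S 1 (P a b)) (n : ℤ) (a b : V) :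
    P ((S ^ n) a) ((S ^ n) b) = diagPow S n (P a b) := by
  induction n using Int.induction_on with
  | zero => rw [diagPow_zero]; simp
  | succ n ih =>
    have : ∀ a, (S ^ ((n : ℤ) + 1)) a = S ((S ^ (n : ℤ)) a) := fun a => by
      rw [add_comm, zpow_one_add, AlgEquiv.mul_apply]
    rw [this, this, hS, ih, diagPow_diagPow, add_comm]
  | pred n ih =>
    have : ∀ a, (S ^ (-(n : ℤ))) a = S ((S ^ (-(n : ℤ) - 1)) a) := fun a => by
      rw [← AlgEquiv.mul_apply, ← zpow_one_add]; congr 2; ring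
    rw [this, this, hS] at ih
    have h2 := congrArg (diagPow S (-1)) ih
    rw [diagPow_diagPow, diagPow_diagPow, neg_add_cancel, diagPow_zero] at h2
    rw [h2, show -1 + -(n : ℤ) = -(n : ℤ) - 1 by ring]

theorem IsLambdaBracket.coeff_zero_equivariant (h : IsLambdaBracket S B) (n : ℤ) (a b : V) :
    B.coeff 0 ((S ^ n) a) ((S ^ n) b) = diagPow S n (B.coeff 0 a b) :=
  equivariant_zpow (fun a b => by rw [h.sesq_right, h.sesq_left]; simp) n a b

theorem IsSkew.coeff_zero (h : IsSkew S B) (a b : V) :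
    B.coeff 0 a b = - flip (B.coeff 0 b a) := by
  have := h a b 0
  rwa [diagPow_zero, neg_zero] at this

/-- The coefficient of `λᵐ μⁿ` at `(a, b, c)` is the Jacobiator of `B.coeff 0` at `(Sᵐ a, Sⁿ b, c)`.
In the third term this uses equivariance: `Sⁿ` applied to the bracket of `Sᵐ⁻ⁿ a` and `b` is the
bracket of `Sᵐ a` and `Sⁿ b`. -/
theorem IsLambdaBracket.isJacobi_iff (h : IsLambdaBracket S B) :
    IsJacobi S B ↔ ∀ a b c, jacobiator (B.coeff 0) a b c = 0 := by
  have key : ∀ (a b c : V) (m n : ℤ), brL B m a (B.coeff n b c) - brR B n b (B.coeff m a c)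
      - brArgL S B n c (B.coeff (m - n) a b) =
      jacobiator (B.coeff 0) ((S ^ m) a) ((S ^ n) b) c := by
    intro a b c m n
    have h3 : ∀ t : V ⊗[K] V, brArgL S B n c t =
        insertMiddle (((B.coeff 0).flip c).rTensor V (diagPow S n t)) := by
      intro t
      induction t using TensorProduct.induction_on with
      | zero => simp
      | add x y hx hy => simp only [map_add, hx, hy]
      | tmul x y => simp [brArgL, h.coeff_eq n x]
    rw [jacobiator_apply, h3, h.coeff_eq (m - n), ← h.coeff_zero_equivariant,
      ← AlgEquiv.mul_apply, ← zpow_add, add_sub_cancel, brL, brR, h.coeff_eq n b, h.coeff_eq m a]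
    rfl
  constructor
  · intro hJ a b c
    have := hJ a b c 0 0
    rw [key] at this
    simpa using this
  · intro hJ a b c m n
    rw [key, hJ]

/-- The `λ`-map with coefficients `P (Sⁿ a) b`. -/
def lambdaOfBracket (S : V ≃ₐ[K] V) (P : V →ₗ[K] V →ₗ[K] V ⊗[K] V)
    (hfin : ∀ a b, (Function.support fun n : ℤ => P ((S ^ n) a) b).Finite) : LambdaMap K V :=
  LinearMap.mk₂ K (fun a b => Finsupp.ofSupportFinite _ (hfin a b))
    (fun a a' b => by ext n; simp [Finsupp.ofSupportFinite_coe])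
    (fun r a b => by ext n; simp [Finsupp.ofSupportFinite_coe])
    (fun a b b' => by ext n; simp [Finsupp.ofSupportFinite_coe])
    (fun r a b => by ext n; simp [Finsupp.ofSupportFinite_coe])

theorem coeff_lambdaOfBracket (P : V →ₗ[K] V →ₗ[K] V ⊗[K] V)
    (hfin : ∀ a b, (Function.support fun n : ℤ => P ((S ^ n) a) b).Finite) (n : ℤ) (a b : V) :
    (lambdaOfBracket S P hfin).coeff n a b = P ((S ^ n) a) b := rfl

theorem isLambdaBracket_lambdaOfBracket {P : V →ₗ[K] V →ₗ[K] V ⊗[K] V} (hP : IsDoubleBracket P)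
    (hS : ∀ a b, P (S a) (S b) = diagPow S 1 (P a b))
    (hfin : ∀ a b, (Function.support fun n : ℤ => P ((S ^ n) a) b).Finite) :
    IsLambdaBracket S (lambdaOfBracket S P hfin) where
  sesq_left a b n := by
    simp only [coeff_lambdaOfBracket, zpow_add, AlgEquiv.mul_apply, zpow_one]
  sesq_right a b n := by
    simp only [coeff_lambdaOfBracket]
    rw [← hS, ← AlgEquiv.mul_apply, ← zpow_one_add, add_sub_cancel]
  leibniz_left a b c n := by simp only [coeff_lambdaOfBracket, hP.left]
  leibniz_right a b c n := by simp only [coeff_lambdaOfBracket, map_mul, hP.right]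

theorem isSkew_lambdaOfBracket {P : V →ₗ[K] V →ₗ[K] V ⊗[K] V}
    (hS : ∀ a b, P (S a) (S b) = diagPow S 1 (P a b)) (hskew : ∀ a b, P a b = - flip (P b a))
    (hfin : ∀ a b, (Function.support fun n : ℤ => P ((S ^ n) a) b).Finite) :
    IsSkew S (lambdaOfBracket S P hfin) := by
  intro a b n
  simp only [coeff_lambdaOfBracket]
  rw [← flip_diagPow, ← equivariant_zpow hS, hskew, ← AlgEquiv.mul_apply, ← zpow_add,
    add_neg_cancel, zpow_zero, AlgEquiv.one_apply]

end LambdaBracket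

/-! ### The bracket on `R2` determined by `g` and `k` -/

section R2

variable {K : Type*} [Field K]

theorem shift_ι (p : Fin 2 × ℤ) :
    shift K (FreeAlgebra.ι K p) = FreeAlgebra.ι K (p.1, p.2 + 1) :=
  FreeAlgebra.lift_ι_apply _ _

theorem shift_zpow_ι (n : ℤ) (p : Fin 2 × ℤ) :
    (shift K ^ n) (FreeAlgebra.ι K p) = FreeAlgebra.ι K (p.1, p.2 + n) := by
  induction n using Int.induction_on with
  | zero => simp
  | succ n ih =>
    rw [add_comm, zpow_one_add, AlgEquiv.mul_apply, ih, shift_ι]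
    exact congrArg (fun i => FreeAlgebra.ι K (p.1, i)) (by ring)
  | pred n ih =>
    apply (shift K).injective
    rw [← AlgEquiv.mul_apply, ← zpow_one_add, add_sub_cancel, ih, shift_ι]
    exact congrArg (fun i => FreeAlgebra.ι K (p.1, i)) (by ring)

theorem not_isOfFinOrder_shift : ¬ IsOfFinOrder (shift K) := by
  rw [isOfFinOrder_iff_pow_eq_one]
  rintro ⟨n, hn, h⟩
  have h1 := shift_zpow_ι (K := K) n (0, 0)
  rw [zpow_natCast, h, AlgEquiv.one_apply] at h1
  have h2 := FreeAlgebra.ι_injective h1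
  simp only [Prod.mk.injEq, true_and] at h2
  omega

/-- The values on generators of the double bracket underlying the `λ`-bracket determined by
`{{u_λ v}} = g λᵏ`. -/
def generatorBracket (k : ℤ) (g : R2 K ⊗[K] R2 K) (p q : Fin 2 × ℤ) : R2 K ⊗[K] R2 K :=
  if p.1 = 0 ∧ q.1 = 1 ∧ p.2 = q.2 + k then diagPow (shift K) q.2 g
  else if p.1 = 1 ∧ q.1 = 0 ∧ q.2 = p.2 + k then - flip (diagPow (shift K) p.2 g)
  else 0

theorem generatorBracket_skew (k : ℤ) (g : R2 K ⊗[K] R2 K) (p q : Fin 2 × ℤ) :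
    generatorBracket k g p q = - flip (generatorBracket k g q p) := by
  obtain ⟨e, i⟩ := p
  obtain ⟨f, j⟩ := q
  fin_cases e <;> fin_cases f <;> simp [generatorBracket] <;> split_ifs <;> simp [flip_flip]

theorem generatorBracket_shift (k : ℤ) (g : R2 K ⊗[K] R2 K) (p q : Fin 2 × ℤ) :
    generatorBracket k g (p.1, p.2 + 1) (q.1, q.2 + 1) =
      diagPow (shift K) 1 (generatorBracket k g p q) := by
  obtain ⟨e, i⟩ := p
  obtain ⟨f, j⟩ := q
  have h1 : i + 1 = j + 1 + k ↔ i = j + k := by constructor <;> intro h <;> omega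
  have h2 : j + 1 = i + 1 + k ↔ j = i + k := by constructor <;> intro h <;> omega
  fin_cases e <;> fin_cases f <;> simp [generatorBracket, h1, h2] <;> split_ifs <;>
    simp [← flip_diagPow, diagPow_diagPow, add_comm]

/-- A double bracket on `R2` whose values on generators are those of a monomial `λ`-bracket. -/
structure IsMonomialDoubleBracket (k : ℤ) (g : R2 K ⊗[K] R2 K)
    (P : R2 K →ₗ[K] R2 K →ₗ[K] R2 K ⊗[K] R2 K) : Prop where
  isDoubleBracket : IsDoubleBracket P
  ι_ι : ∀ p q, P (FreeAlgebra.ι K p) (FreeAlgebra.ι K q) = generatorBracket k g p q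

variable {k : ℤ} {g : R2 K ⊗[K] R2 K} {P : R2 K →ₗ[K] R2 K →ₗ[K] R2 K ⊗[K] R2 K}

/-- The negative flipped opposite `Q` of `P` is again a double bracket, since flipping exchanges
inner and outer actions. It agrees with `P` on generators, hence everywhere. Equivariance is proved
the same way, with `Q` the conjugate of `P` by the shift. -/
theorem IsMonomialDoubleBracket.skew (h : IsMonomialDoubleBracket k g P) (a b : R2 K) :
    P a b = - flip (P b a) := by
  let Q : R2 K →ₗ[K] R2 K →ₗ[K] R2 K ⊗[K] R2 K := - P.flip.compr₂ flip
  have hQ : ∀ a b, Q a b = - flip (P b a) := fun _ _ => rfl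
  have hQ' : IsDoubleBracket Q := by
    constructor
    · intro a b c
      simp only [hQ, h.isDoubleBracket.right, map_add, map_neg, flip_innerLeft, flip_innerRight]
      abel
    · intro a b c
      simp only [hQ, h.isDoubleBracket.left, map_add, map_neg, flip_outerLeft, flip_outerRight]
      abel
  have : P = Q := h.isDoubleBracket.ext_of_ι hQ' fun x y => by
    rw [hQ, h.ι_ι, h.ι_ι, generatorBracket_skew]
  rw [← hQ, ← this]

theorem IsMonomialDoubleBracket.equivariant (h : IsMonomialDoubleBracket k g P) (a b : R2 K) :
    P (shift K a) (shift K b) = diagPow (shift K) 1 (P a b) := by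
  let Q : R2 K →ₗ[K] R2 K →ₗ[K] R2 K ⊗[K] R2 K :=
    (P.compl₁₂ (shift K).toLinearMap (shift K).toLinearMap).compr₂ (diagPow (shift K) (-1))
  have hQ : ∀ a b, Q a b = diagPow (shift K) (-1) (P (shift K a) (shift K b)) := fun _ _ => rfl
  have inv : ∀ x, (shift K ^ (-1 : ℤ)) (shift K x) = x := fun x => by
    rw [zpow_neg_one, ← AlgEquiv.mul_apply, inv_mul_cancel, AlgEquiv.one_apply]
  have hQ' : IsDoubleBracket Q := by
    constructor
    · intro a b c
      simp only [hQ, map_mul, h.isDoubleBracket.left, map_add]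
      rw [diagPow, diag_outerLeft, diag_outerRight]
      erw [inv, inv]
    · intro a b c
      simp only [hQ, map_mul, h.isDoubleBracket.right, map_add]
      rw [diagPow, diag_innerLeft, diag_innerRight]
      erw [inv, inv]
  have : P = Q := h.isDoubleBracket.ext_of_ι hQ' fun x y => by
    rw [hQ, shift_ι, shift_ι, h.ι_ι, h.ι_ι, generatorBracket_shift, diagPow_diagPow,
      neg_add_cancel, diagPow_zero]
  conv_rhs => rw [this, hQ, diagPow_diagPow, add_neg_cancel, diagPow_zero]

theorem IsMonomialDoubleBracket.finite (h : IsMonomialDoubleBracket k g P) (a b : R2 K) :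
    (Function.support fun n : ℤ => P ((shift K ^ n) a) b).Finite := by
  have hb1 : ∀ a, P a 1 = 0 := fun a => by simpa using h.isDoubleBracket.left a 1 1
  have ha1 : ∀ b, P 1 b = 0 := fun b => by simpa using h.isDoubleBracket.right 1 1 b
  have of_imp : ∀ f f' f'' : ℤ → R2 K ⊗[K] R2 K, (Function.support f).Finite →
      (Function.support f').Finite → (∀ n, f n = 0 → f' n = 0 → f'' n = 0) →
      (Function.support f'').Finite := by
    intro f f' f'' hf hf' himp
    refine (hf.union hf').subset fun n hn => ?_
    by_contra hcon
    simp only [Set.mem_union, Function.mem_support, not_or, not_not] at hcon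
    exact hn (himp n hcon.1 hcon.2)
  induction a using FreeAlgebra.induction with
  | grade0 r => simp [Algebra.algebraMap_eq_smul_one, ha1]
  | mul a a' ha ha' =>
    refine of_imp _ _ _ ha ha' fun n h1 h2 => ?_
    simp only [map_mul, h.isDoubleBracket.right, h1, h2, map_zero, add_zero]
  | add a a' ha ha' =>
    refine of_imp _ _ _ ha ha' fun n h1 h2 => ?_
    simp only [map_add, LinearMap.add_apply, h1, h2, add_zero]
  | grade1 p =>
    induction b using FreeAlgebra.induction with
    | grade0 r => simp [Algebra.algebraMap_eq_smul_one, hb1]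
    | mul b b' hb hb' =>
      refine of_imp _ _ _ hb hb' fun n h1 h2 => ?_
      simp only [h.isDoubleBracket.left, h1, h2, map_zero, add_zero]
    | add b b' hb hb' =>
      refine of_imp _ _ _ hb hb' fun n h1 h2 => ?_
      simp only [map_add, h1, h2, add_zero]
    | grade1 q =>
      -- The two exponents solve `p.2 + n = q.2 + k` and `q.2 = p.2 + n + k`, the conditions under
      -- which `generatorBracket` can be nonzero.
      refine (Set.toFinite {q.2 + k - p.2, q.2 - k - p.2}).subset fun n hn => ?_
      rw [Function.mem_support, shift_zpow_ι, h.ι_ι, generatorBracket] at hn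
      simp only [Set.mem_insert_iff, Set.mem_singleton_iff]
      split_ifs at hn with h1 h2
      · left; have := h1.2.2; simp only at this; omega
      · right; have := h2.2.2; simp only at this; omega
      · exact absurd rfl hn

theorem u_eq (n : ℤ) : u K n = FreeAlgebra.ι K (0, n) := rfl
theorem v_eq (n : ℤ) : v K n = FreeAlgebra.ι K (1, n) := rfl

theorem IsMonomialDoubleBracket.isMonomialBracket (h : IsMonomialDoubleBracket k g P) :
    IsMonomialBracket k g (lambdaOfBracket (shift K) P h.finite) where
  bracket := isLambdaBracket_lambdaOfBracket h.isDoubleBracket h.equivariant h.finite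
  skew := isSkew_lambdaOfBracket h.equivariant h.skew h.finite
  uu := by
    ext n
    change P ((shift K ^ n) (u K 0)) (u K 0) = 0
    rw [u_eq, shift_zpow_ι, h.ι_ι]
    simp [generatorBracket]
  vv := by
    ext n
    change P ((shift K ^ n) (v K 0)) (v K 0) = 0
    rw [v_eq, shift_zpow_ι, h.ι_ι]
    simp [generatorBracket]
  uv := by
    ext n
    change P ((shift K ^ n) (u K 0)) (v K 0) = _
    rw [u_eq, v_eq, shift_zpow_ι, h.ι_ι, Finsupp.single_apply]
    by_cases hn : k = n
    · subst hn; simp [generatorBracket, diagPow_zero]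
    · simp [generatorBracket, hn, Ne.symm hn]

theorem IsMonomialBracket.coeff_zero {B : LambdaMap K (R2 K)} (h : IsMonomialBracket k g B) :
    IsMonomialDoubleBracket k g (B.coeff 0) where
  isDoubleBracket := h.bracket.isDoubleBracket
  ι_ι := by
    -- Equivariance moves the second index to `0`; only the difference of the indices matters.
    have main : ∀ e f i j, B.coeff 0 (FreeAlgebra.ι K (e, i)) (FreeAlgebra.ι K (f, j)) =
        diagPow (shift K) j
          (B (FreeAlgebra.ι K (e, 0)) (FreeAlgebra.ι K (f, 0)) (i - j)) := by
      intro e f i j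
      change _ = diagPow (shift K) j
        (B.coeff (i - j) (FreeAlgebra.ι K (e, 0)) (FreeAlgebra.ι K (f, 0)))
      rw [h.bracket.coeff_eq (i - j), ← h.bracket.coeff_zero_equivariant, ← AlgEquiv.mul_apply,
        ← zpow_add, shift_zpow_ι, shift_zpow_ι]
      simp
    have hUV : ∀ i j, B.coeff 0 (FreeAlgebra.ι K (0, i)) (FreeAlgebra.ι K (1, j)) =
        generatorBracket k g (0, i) (1, j) := fun i j => by
      rw [main, ← u_eq, ← v_eq, h.uv, Finsupp.single_apply]
      by_cases hk : k = i - j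
      · have : i = j + k := by omega
        simp [generatorBracket, this]
      · have : ¬ i = j + k := by omega
        simp [generatorBracket, this, hk]
    rintro ⟨e, i⟩ ⟨f, j⟩
    fin_cases e <;> fin_cases f
    · change B.coeff 0 (FreeAlgebra.ι K (0, i)) (FreeAlgebra.ι K (0, j)) =
        generatorBracket k g (0, i) (0, j)
      rw [main, ← u_eq, h.uu]
      simp [generatorBracket]
    · exact hUV i j
    · change B.coeff 0 (FreeAlgebra.ι K (1, i)) (FreeAlgebra.ι K (0, j)) =
        generatorBracket k g (1, i) (0, j)
      rw [h.skew.coeff_zero, hUV, ← generatorBracket_skew]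
    · change B.coeff 0 (FreeAlgebra.ι K (1, i)) (FreeAlgebra.ι K (1, j)) =
        generatorBracket k g (1, i) (1, j)
      rw [main, ← v_eq, h.vv]
      simp [generatorBracket]

theorem existsUnique_isMonomialBracket (k : ℤ) (g : R2 K ⊗[K] R2 K) :
    ∃! B : LambdaMap K (R2 K), IsMonomialBracket k g B := by
  obtain ⟨P, hP, hPι⟩ := exists_isDoubleBracket (generatorBracket k g)
  refine ⟨_, (IsMonomialDoubleBracket.mk hP hPι).isMonomialBracket, fun B hB => ?_⟩
  have : B.coeff 0 = P := hB.bracket.isDoubleBracket.ext_of_ι hP fun p q => by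
    rw [hB.coeff_zero.ι_ι, hPι]
  refine LinearMap.ext fun a => LinearMap.ext fun b => Finsupp.ext fun n => ?_
  change B.coeff n a b = P ((shift K ^ n) a) b
  rw [hB.bracket.coeff_eq, this]

theorem IsMonomialBracket.isDoubleMPVA_iff {B : LambdaMap K (R2 K)}
    (h : IsMonomialBracket k g B) :
    IsDoubleMPVA (shift K) B ↔ ∀ p q r, jacobiator (B.coeff 0) (FreeAlgebra.ι K p)
      (FreeAlgebra.ι K q) (FreeAlgebra.ι K r) = 0 :=
  ⟨fun hB _ _ _ => h.bracket.isJacobi_iff.1 hB.jacobi _ _ _,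
    fun hJ => ⟨not_isOfFinOrder_shift, h.bracket, h.skew, h.bracket.isJacobi_iff.2
      (jacobiator_eq_zero_of_ι h.coeff_zero.isDoubleBracket h.coeff_zero.skew hJ)⟩⟩

end R2

/-! ### Coefficients of words, and how derivations act on them -/

section Words

variable {K : Type*} [Field K] {X : Type*}

/-- The monomial of a free algebra given by a word. -/
def word (K : Type*) [Field K] {X : Type*} (l : List X) : FreeAlgebra K X :=
  (l.map (FreeAlgebra.ι K)).prod

theorem word_nil : word K ([] : List X) = 1 := rfl
theorem word_cons (x : X) (l : List X) : word K (x :: l) = FreeAlgebra.ι K x * word K l := by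
  simp [word]
theorem word_append (l m : List X) : word K (l ++ m) = word K l * word K m := by
  simp [word]

/-- The basis of a free algebra consisting of words. -/
def wordBasis (K : Type*) [Field K] (X : Type*) : Module.Basis (List X) K (FreeAlgebra K X) :=
  (FreeAlgebra.basisFreeMonoid K X).reindex FreeMonoid.toList

theorem wordBasis_apply (l : List X) : wordBasis K X l = word K l := by
  have h : FreeAlgebra.equivMonoidAlgebraFreeMonoid (R := K) (word K l) =
      MonoidAlgebra.of K (FreeMonoid X) (FreeMonoid.ofList l) := by
    induction l with
    | nil => rw [word_nil, map_one]; rfl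
    | cons x l ih =>
      rw [word_cons, map_mul, ih, FreeMonoid.ofList_cons, map_mul]
      congr 1
      simp [FreeAlgebra.equivMonoidAlgebraFreeMonoid]
  rw [wordBasis, Module.Basis.reindex_apply, FreeAlgebra.basisFreeMonoid,
    Module.Basis.map_apply]
  refine (LinearEquiv.symm_apply_eq _).2 ?_
  simp only [LinearEquiv.trans_apply]
  change _ = MonoidAlgebra.coeffLinearEquiv _
    (FreeAlgebra.equivMonoidAlgebraFreeMonoid (R := K) (word K l))
  rw [h]
  simp

/-- The coefficient of a word in an element of a free algebra. -/
def wcoef (A : List X) : FreeAlgebra K X →ₗ[K] K := (wordBasis K X).coord A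

theorem wcoef_word [DecidableEq X] (A B : List X) :
    wcoef A (word K B) = if B = A then 1 else 0 := by
  rw [wcoef, ← wordBasis_apply, Module.Basis.coord_apply, Module.Basis.repr_self,
    Finsupp.single_apply]

/-- The coefficient of `A ⊗ B`, for words `A` and `B`. -/
def wcoef₂ (A B : List X) : FreeAlgebra K X ⊗[K] FreeAlgebra K X →ₗ[K] K :=
  LinearMap.mul' K K ∘ₗ TensorProduct.map (wcoef A) (wcoef B)

/-- The coefficient of `A ⊗ B ⊗ C`, for words `A`, `B` and `C`. -/
def wcoef₃ (A B C : List X) :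
    FreeAlgebra K X ⊗[K] (FreeAlgebra K X ⊗[K] FreeAlgebra K X) →ₗ[K] K :=
  LinearMap.mul' K K ∘ₗ TensorProduct.map (wcoef A) (wcoef₂ B C)

theorem wcoef₂_tmul (A B : List X) (a b : FreeAlgebra K X) :
    wcoef₂ A B (a ⊗ₜ[K] b) = wcoef A a * wcoef B b := rfl

theorem wcoef₃_tmul (A B C : List X) (a : FreeAlgebra K X)
    (t : FreeAlgebra K X ⊗[K] FreeAlgebra K X) :
    wcoef₃ A B C (a ⊗ₜ[K] t) = wcoef A a * wcoef₂ B C t := rfl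

theorem wcoef₂_flip (A B : List X) (t : FreeAlgebra K X ⊗[K] FreeAlgebra K X) :
    wcoef₂ A B (flip t) = wcoef₂ B A t := by
  induction t using TensorProduct.induction_on with
  | zero => simp
  | add x y hx hy => simp only [map_add, hx, hy]
  | tmul x y => rw [flip_tmul, wcoef₂_tmul, wcoef₂_tmul, mul_comm]

theorem wcoef₂_eq_repr (A B : List X) (t : FreeAlgebra K X ⊗[K] FreeAlgebra K X) :
    wcoef₂ A B t = ((wordBasis K X).tensorProduct (wordBasis K X)).repr t (A, B) := by
  induction t using TensorProduct.induction_on with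
  | zero => simp
  | add x y hx hy => simp only [map_add, hx, hy, Finsupp.add_apply]
  | tmul x y =>
    rw [wcoef₂_tmul, Module.Basis.tensorProduct_repr_tmul_apply, smul_eq_mul, mul_comm]; rfl

theorem ext_wcoef₂ {s t : FreeAlgebra K X ⊗[K] FreeAlgebra K X}
    (h : ∀ A B, wcoef₂ A B s = wcoef₂ A B t) : s = t := by
  refine ((wordBasis K X).tensorProduct (wordBasis K X)).ext_elem fun ⟨A, B⟩ => ?_
  rw [← wcoef₂_eq_repr, ← wcoef₂_eq_repr, h]

theorem finite_support_wcoef₂ (t : FreeAlgebra K X ⊗[K] FreeAlgebra K X) :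
    {p : List X × List X | wcoef₂ p.1 p.2 t ≠ 0}.Finite := by
  simp only [wcoef₂_eq_repr]
  exact Finsupp.hasFiniteSupport _

theorem ext_on_words {M : Type*} [AddCommGroup M] [Module K M] {f g : FreeAlgebra K X →ₗ[K] M}
    (h : ∀ l, f (word K l) = g (word K l)) : f = g :=
  (wordBasis K X).ext fun l => by rw [wordBasis_apply, h]

theorem wcoef_cons_ι_mul [DecidableEq X] (x y : X) (A : List X) (a : FreeAlgebra K X) :
    wcoef (x :: A) (FreeAlgebra.ι K y * a) = if y = x then wcoef A a else 0 := by
  have : wcoef (x :: A) ∘ₗ LinearMap.mulLeft K (FreeAlgebra.ι K y) =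
      (if y = x then (1 : K) else 0) • wcoef A := by
    refine ext_on_words fun l => ?_
    simp only [LinearMap.comp_apply, LinearMap.mulLeft_apply, ← word_cons, wcoef_word,
      LinearMap.smul_apply]
    by_cases h : y = x <;> simp [h]
  have h2 := DFunLike.congr_fun this a
  simp only [LinearMap.comp_apply, LinearMap.mulLeft_apply, LinearMap.smul_apply, smul_eq_mul,
    ite_mul, one_mul, zero_mul] at h2
  exact h2

theorem wcoef_nil_ι_mul (y : X) (a : FreeAlgebra K X) :
    wcoef [] (FreeAlgebra.ι K y * a) = 0 := by
  classical
  have : wcoef [] ∘ₗ LinearMap.mulLeft K (FreeAlgebra.ι K y) = 0 := by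
    refine ext_on_words fun l => ?_
    simp [← word_cons, wcoef_word]
  exact DFunLike.congr_fun this a

theorem wcoef_mul_word [DecidableEq X] (B l : List X) (a : FreeAlgebra K X) :
    wcoef B (a * word K l) =
      ∑ j ∈ Finset.range (B.length + 1), if B.drop j = l then wcoef (B.take j) a else 0 := by
  have : wcoef B ∘ₗ LinearMap.mulRight K (word K l) = ∑ j ∈ Finset.range (B.length + 1),
      (if B.drop j = l then (1 : K) else 0) • wcoef (B.take j) := by
    refine ext_on_words fun m => ?_
    simp only [LinearMap.comp_apply, LinearMap.mulRight_apply, ← word_append, wcoef_word,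
      LinearMap.smul_apply, LinearMap.sum_apply, smul_eq_mul, mul_ite, mul_one, mul_zero]
    by_cases h : m ++ l = B
    · subst h
      rw [Finset.sum_eq_single m.length]
      · simp
      · intro j hj hne
        rw [if_neg]
        intro h
        refine hne ?_
        rw [h, List.length_take]
        simp only [List.length_append, Finset.mem_range] at hj ⊢
        omega
      · simp
    · rw [if_neg h, Finset.sum_eq_zero]
      intro j hj
      split_ifs with h1 h2
      · exact absurd (by rw [h1, ← h2, List.take_append_drop]) h
      · rfl
      · rfl
  have h2 := DFunLike.congr_fun this a
  simp only [LinearMap.comp_apply, LinearMap.mulRight_apply, LinearMap.sum_apply,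
    LinearMap.smul_apply, smul_eq_mul, ite_mul, one_mul, zero_mul] at h2
  exact h2

/-- The coefficients of the value of a derivation which is `γ` on the letter `y` and zero on
the other letters. -/
theorem wcoef₂_derivation (D : FreeAlgebra K X →ₗ[K] FreeAlgebra K X ⊗[K] FreeAlgebra K X)
    (hD : ∀ a b, D (a * b) = outerRight b (D a) + outerLeft a (D b)) (y : X)
    (hy : ∀ x, x ≠ y → D (FreeAlgebra.ι K x) = 0) (A B : List X) (a : FreeAlgebra K X) :
    wcoef₂ A B (D a) = ∑ i ∈ Finset.range (A.length + 1), ∑ j ∈ Finset.range (B.length + 1),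
      wcoef (A.take i ++ y :: B.drop j) a *
        wcoef₂ (A.drop i) (B.take j) (D (FreeAlgebra.ι K y)) := by
  classical
  -- An occurrence of `y` in a word `w₁ y w₂` contributes `w₁ α ⊗ β w₂` for each term `α ⊗ β` of `D
  -- y`. The coefficient of `A ⊗ B` therefore runs over all cuts `A = w₁ α`, `B = β w₂`.
  suffices h : wcoef₂ A B ∘ₗ D = ∑ i ∈ Finset.range (A.length + 1),
      ∑ j ∈ Finset.range (B.length + 1),
      wcoef₂ (A.drop i) (B.take j) (D (FreeAlgebra.ι K y)) •
        wcoef (A.take i ++ y :: B.drop j) by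
    have h2 := DFunLike.congr_fun h a
    simp only [LinearMap.sum_apply, LinearMap.smul_apply, smul_eq_mul,
      mul_comm (wcoef₂ _ _ _)] at h2
    exact h2
  refine ext_on_words fun l => ?_
  simp only [LinearMap.sum_apply, LinearMap.smul_apply, smul_eq_mul, LinearMap.comp_apply]
  induction l generalizing A with
  | nil =>
    have h1 : D 1 = 0 := by simpa using hD 1 1
    rw [word_nil, h1, map_zero, ← word_nil, eq_comm]
    refine Finset.sum_eq_zero fun i _ => Finset.sum_eq_zero fun j _ => ?_
    rw [wcoef_word, if_neg (by simp), mul_zero]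
  | cons z l ih =>
    rw [word_cons, hD, map_add]
    have e1 : ∀ t : FreeAlgebra K X ⊗[K] FreeAlgebra K X, wcoef₂ A B (outerRight (word K l) t) =
        ∑ j ∈ Finset.range (B.length + 1),
          if B.drop j = l then wcoef₂ A (B.take j) t else 0 := by
      intro t
      induction t using TensorProduct.induction_on with
      | zero => simp
      | add x y hx hy =>
        simp only [map_add, hx, hy, ← Finset.sum_add_distrib]
        refine Finset.sum_congr rfl fun j _ => ?_
        split_ifs <;> simp
      | tmul x y => simp only [outerRight_tmul, wcoef₂_tmul, wcoef_mul_word, Finset.mul_sum,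
          mul_ite, mul_zero]
    have e2 : wcoef₂ A B (outerRight (word K l) (D (FreeAlgebra.ι K z))) =
        ∑ j ∈ Finset.range (B.length + 1), wcoef₂ A (B.take j) (D (FreeAlgebra.ι K y)) *
          wcoef (y :: B.drop j) (FreeAlgebra.ι K z * word K l) := by
      rw [e1]
      refine Finset.sum_congr rfl fun j _ => ?_
      rw [wcoef_cons_ι_mul, wcoef_word]
      by_cases hz : z = y
      · subst hz; simp [eq_comm]
      · simp [hz, hy z hz]
    have e3 : ∀ t : FreeAlgebra K X ⊗[K] FreeAlgebra K X, ∀ x A',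
        wcoef₂ (x :: A') B (outerLeft (FreeAlgebra.ι K z) t) =
        if z = x then wcoef₂ A' B t else 0 := by
      intro t x A'
      induction t using TensorProduct.induction_on with
      | zero => simp
      | add x y hx hy =>
        simp only [map_add, hx, hy]
        split_ifs <;> simp
      | tmul x y => simp only [outerLeft_tmul, wcoef₂_tmul, wcoef_cons_ι_mul, ite_mul, zero_mul]
    have e4 : ∀ t : FreeAlgebra K X ⊗[K] FreeAlgebra K X,
        wcoef₂ [] B (outerLeft (FreeAlgebra.ι K z) t) = 0 := by
      intro t
      induction t using TensorProduct.induction_on with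
      | zero => simp
      | add x y hx hy => simp only [map_add, hx, hy, add_zero]
      | tmul x y => simp only [outerLeft_tmul, wcoef₂_tmul, wcoef_nil_ι_mul, zero_mul]
    -- The cut `i = 0` accounts for differentiating the first letter `z`; the cuts `i ≥ 1` keep `z`
    -- and come from the induction hypothesis.
    rw [Finset.sum_range_succ', add_comm, e2]
    simp only [List.take_zero, List.drop_zero, List.nil_append]
    congr 1
    cases A with
    | nil => simp [e4]
    | cons x A' =>
      rw [e3]
      simp only [List.length_cons, List.take_succ_cons, List.drop_succ_cons, List.cons_append,
        wcoef_cons_ι_mul]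
      split_ifs with hz
      · exact ih A'
      · simp

theorem wcoef₃_derivation_left
    (D : FreeAlgebra K X →ₗ[K] FreeAlgebra K X ⊗[K] FreeAlgebra K X)
    (hD : ∀ a b, D (a * b) = outerRight b (D a) + outerLeft a (D b)) (y : X)
    (hy : ∀ x, x ≠ y → D (FreeAlgebra.ι K x) = 0) (A B C : List X)
    (t : FreeAlgebra K X ⊗[K] FreeAlgebra K X) :
    wcoef₃ A B C (assocMap (D.rTensor _ t)) =
      ∑ i ∈ Finset.range (A.length + 1), ∑ j ∈ Finset.range (B.length + 1),
        wcoef₂ (A.take i ++ y :: B.drop j) C t *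
          wcoef₂ (A.drop i) (B.take j) (D (FreeAlgebra.ι K y)) := by
  induction t using TensorProduct.induction_on with
  | zero => simp
  | add s t hs ht => simp only [map_add, hs, ht, add_mul, Finset.sum_add_distrib]
  | tmul a c =>
    have : ∀ s : FreeAlgebra K X ⊗[K] FreeAlgebra K X,
        wcoef₃ A B C (assocMap (s ⊗ₜ[K] c)) = wcoef₂ A B s * wcoef C c := by
      intro s
      induction s using TensorProduct.induction_on with
      | zero => simp
      | add s t hs ht => simp only [map_add, TensorProduct.add_tmul, hs, ht, add_mul]
      | tmul p q =>
        change wcoef₃ A B C (p ⊗ₜ[K] (q ⊗ₜ[K] c)) = _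
        rw [wcoef₃_tmul, wcoef₂_tmul, wcoef₂_tmul, mul_assoc]
    rw [LinearMap.rTensor_tmul, this, wcoef₂_derivation D hD y hy, Finset.sum_mul]
    refine Finset.sum_congr rfl fun i _ => ?_
    rw [Finset.sum_mul]
    refine Finset.sum_congr rfl fun j _ => ?_
    rw [wcoef₂_tmul]; ring

theorem wcoef₃_derivation_right
    (D : FreeAlgebra K X →ₗ[K] FreeAlgebra K X ⊗[K] FreeAlgebra K X)
    (hD : ∀ a b, D (a * b) = outerRight b (D a) + outerLeft a (D b)) (y : X)
    (hy : ∀ x, x ≠ y → D (FreeAlgebra.ι K x) = 0) (A B C : List X)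
    (t : FreeAlgebra K X ⊗[K] FreeAlgebra K X) :
    wcoef₃ A B C (D.lTensor _ t) =
      ∑ i ∈ Finset.range (B.length + 1), ∑ j ∈ Finset.range (C.length + 1),
        wcoef₂ A (B.take i ++ y :: C.drop j) t *
          wcoef₂ (B.drop i) (C.take j) (D (FreeAlgebra.ι K y)) := by
  induction t using TensorProduct.induction_on with
  | zero => simp
  | add s t hs ht => simp only [map_add, hs, ht, add_mul, Finset.sum_add_distrib]
  | tmul a c =>
    rw [LinearMap.lTensor_tmul, wcoef₃_tmul, wcoef₂_derivation D hD y hy, Finset.mul_sum]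
    refine Finset.sum_congr rfl fun i _ => ?_
    rw [Finset.mul_sum]
    refine Finset.sum_congr rfl fun j _ => ?_
    rw [wcoef₂_tmul]; ring

end Words

/-! ### Leading terms and degree bounds -/

section LeadingTerms

variable {K : Type*} [Field K] {X : Type*}

/-- A pair of finitely supported functions of pairs of words has a product, for the
multiplication `(w₁, w₂) (α, β) = (w₁ α, β w₂)`, with a nonzero coefficient in a degree `m` that
is bounded below by degrees occurring in the factors. -/
theorem exists_split_sum_ne_zero (f γ : List X → List X → K)
    (hf : {p : List X × List X | f p.1 p.2 ≠ 0}.Finite)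
    (hγ : {p : List X × List X | γ p.1 p.2 ≠ 0}.Finite) (m : List X → List X → ℕ)
    (hm : ∀ w₁ w₂ α β, m (w₁ ++ α) (β ++ w₂) = m w₁ w₂ + m α β)
    {w₁ w₂ α β : List X} (hw : f w₁ w₂ ≠ 0) (hα : γ α β ≠ 0) :
    ∃ A B, m w₁ w₂ + m α β ≤ m A B ∧
      ∑ i ∈ Finset.range (A.length + 1), ∑ j ∈ Finset.range (B.length + 1),
        f (A.take i) (B.drop j) * γ (A.drop i) (B.take j) ≠ 0 := by
  -- Lexicographic refinement of `m` by the two lengths, additive for the product. If both factors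
  -- are taken of maximal weight, any other cut contributing to the same pair must have the same
  -- weights, hence the same lengths, hence the same cut positions: the leading coefficient is a
  -- single nonzero product.
  let wt : List X × List X → ℕ ×ₗ ℕ ×ₗ ℕ := fun p =>
    toLex (m p.1 p.2, toLex (p.1.length, p.2.length))
  have hwt : ∀ w₁ w₂ α β, wt (w₁ ++ α, β ++ w₂) = wt (w₁, w₂) + wt (α, β) := by
    intro w₁ w₂ α β
    simp only [wt, hm, List.length_append, ← toLex_add, Prod.mk_add_mk, add_comm β.length]
  have hle : ∀ p q, wt p ≤ wt q → m p.1 p.2 ≤ m q.1 q.2 := by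
    intro p q h
    rcases (Prod.Lex.le_iff).1 h with h | h
    · exact h.le
    · exact h.1.le
  obtain ⟨⟨u₁, u₂⟩, hu, humax⟩ := Set.exists_max_image _ wt hf ⟨(w₁, w₂), hw⟩
  obtain ⟨⟨a, b⟩, ha, hamax⟩ := Set.exists_max_image _ wt hγ ⟨(α, β), hα⟩
  refine ⟨u₁ ++ a, b ++ u₂, ?_, ?_⟩
  · rw [hm]
    exact add_le_add (hle _ _ (humax (w₁, w₂) hw)) (hle _ _ (hamax (α, β) hα))
  · have huniq : ∀ i ∈ Finset.range ((u₁ ++ a).length + 1),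
        ∀ j ∈ Finset.range ((b ++ u₂).length + 1),
        f ((u₁ ++ a).take i) ((b ++ u₂).drop j) * γ ((u₁ ++ a).drop i) ((b ++ u₂).take j) ≠ 0 →
        i = u₁.length ∧ j = b.length := by
      intro i hi j hj hne
      have h1 := humax (_, _) (left_ne_zero_of_mul hne)
      have h2 := hamax (_, _) (right_ne_zero_of_mul hne)
      have h3 := hwt ((u₁ ++ a).take i) ((b ++ u₂).drop j) ((u₁ ++ a).drop i)
        ((b ++ u₂).take j)
      rw [List.take_append_drop, List.take_append_drop, hwt] at h3
      have h4 := ((add_eq_add_iff_eq_and_eq h1 h2).1 h3.symm).1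
      simp only [wt, EmbeddingLike.apply_eq_iff_eq, Prod.mk.injEq, List.length_take,
        List.length_drop] at h4
      simp only [Finset.mem_range, List.length_append] at hi hj h4
      omega
    rw [Finset.sum_eq_single u₁.length, Finset.sum_eq_single b.length]
    · rw [List.take_left, List.drop_left, List.drop_left, List.take_left]
      exact mul_ne_zero hu ha
    · intro j hj hne
      by_contra h
      exact hne (huniq _ (by simp) j hj h).2
    · intro h; exact absurd (by simp) h
    · intro i hi hne
      refine Finset.sum_eq_zero fun j hj => ?_
      by_contra h
      exact hne (huniq i hi j hj h).1
    · intro h; exact absurd (by simp) h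

theorem finite_splits {P : List X → Prop} (hP : {w | P w}.Finite) (y : X) :
    {p : List X × List X | P (p.1 ++ y :: p.2)}.Finite := by
  refine (hP.biUnion fun w _ => (Set.finite_Iic w.length).image
    fun i => (w.take i, w.drop (i + 1))).subset ?_
  rintro ⟨w₁, w₂⟩ h
  simp only [Set.mem_iUnion]
  refine ⟨_, h, w₁.length, by simp, ?_⟩
  simp

variable {c : List X → List X → K}

theorem finite_left (hc : {p : List X × List X | c p.1 p.2 ≠ 0}.Finite) (C : List X) :
    {A | c A C ≠ 0}.Finite :=
  (hc.image Prod.fst).subset fun A hA => ⟨(A, C), hA, rfl⟩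

theorem finite_right (hc : {p : List X × List X | c p.1 p.2 ≠ 0}.Finite) (A : List X) :
    {C | c A C ≠ 0}.Finite :=
  (hc.image Prod.snd).subset fun C hC => ⟨(A, C), hC, rfl⟩

/-- If `y` occurred in `A`, the pairs `(w₁, w₂)` with `w₁ y w₂ ⊗ C` in the support of `c` would form
a nonzero factor. Its product with `γ ≠ 0` cannot vanish. -/
theorem not_mem_left_of_split_sum_eq_zero (hc : {p : List X × List X | c p.1 p.2 ≠ 0}.Finite)
    {γ : List X → List X → K} (hγ : {p : List X × List X | γ p.1 p.2 ≠ 0}.Finite)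
    (hγ0 : ∃ α β, γ α β ≠ 0) (y : X)
    (h : ∀ A B C : List X, ∑ i ∈ Finset.range (A.length + 1), ∑ j ∈ Finset.range (B.length + 1),
      c (A.take i ++ y :: B.drop j) C * γ (A.drop i) (B.take j) = 0)
    {A C : List X} (hAC : c A C ≠ 0) : y ∉ A := by
  intro hy
  obtain ⟨w₁, w₂, rfl⟩ := List.append_of_mem hy
  obtain ⟨α, β, hα⟩ := hγ0
  obtain ⟨A, B, -, hne⟩ := exists_split_sum_ne_zero (fun w₁ w₂ => c (w₁ ++ y :: w₂) C) γ
    (finite_splits (finite_left hc C) y) hγ (fun _ _ => 0) (by simp) hAC hα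
  exact hne (h A B C)

theorem not_mem_right_of_split_sum_eq_zero (hc : {p : List X × List X | c p.1 p.2 ≠ 0}.Finite)
    {γ : List X → List X → K} (hγ : {p : List X × List X | γ p.1 p.2 ≠ 0}.Finite)
    (hγ0 : ∃ α β, γ α β ≠ 0) (y : X)
    (h : ∀ A B C : List X, ∑ i ∈ Finset.range (B.length + 1), ∑ j ∈ Finset.range (C.length + 1),
      c A (B.take i ++ y :: C.drop j) * γ (B.drop i) (C.take j) = 0)
    {A C : List X} (hAC : c A C ≠ 0) : y ∉ C := by
  intro hy
  obtain ⟨w₁, w₂, rfl⟩ := List.append_of_mem hy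
  obtain ⟨α, β, hα⟩ := hγ0
  obtain ⟨B, C, -, hne⟩ := exists_split_sum_ne_zero (fun w₁ w₂ => c A (w₁ ++ y :: w₂)) γ
    (finite_splits (finite_right hc A) y) hγ (fun _ _ => 0) (by simp) hAC hα
  exact hne (h A B C)

/-- The quadratic equation satisfied by the coefficients `c` of `g` when
`{{u_λ g}}_L = {{u_λ g}}_R`, where the bracket with `u` is `g` on the letter `y` and zero on the
other letters. -/
def SplitEquation (y : X) (c : List X → List X → K) : Prop :=
  ∀ A B C : List X, ∑ i ∈ Finset.range (A.length + 1), ∑ j ∈ Finset.range (B.length + 1),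
      c (A.take i ++ y :: B.drop j) C * c (A.drop i) (B.take j) =
    ∑ i ∈ Finset.range (B.length + 1), ∑ j ∈ Finset.range (C.length + 1),
      c A (B.take i ++ y :: C.drop j) * c (B.drop i) (C.take j)

variable [DecidableEq X]

theorem SplitEquation.count_left_le_one {y : X} (h : SplitEquation y c)
    (hc : {p : List X × List X | c p.1 p.2 ≠ 0}.Finite) {A C : List X} (hAC : c A C ≠ 0) :
    A.count y ≤ 1 := by
  obtain ⟨⟨A₀, C₀⟩, h₀, hmax⟩ := Set.exists_max_image _
    (fun p : List X × List X => p.1.count y) hc ⟨(A, C), hAC⟩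
  refine (hmax (A, C) hAC).trans ?_
  simp only at hmax ⊢
  by_cases hy : y ∈ A₀
  -- Let `N` be the maximal number of `y` in a left word. Cutting at the last `y` leaves `N - 1` of
  -- them in the prefix, so the left side of the equation has a nonzero coefficient whose left word
  -- contains at least `(N - 1) + N` letters `y`. On the right side the left word is one occurring
  -- in `c`, so `2N - 1 ≤ N`.
  · obtain ⟨w₂, w₁, hrev, hw₂⟩ := List.eq_append_cons_of_mem (List.mem_reverse.2 hy)
    have hA₀ : A₀ = w₁.reverse ++ y :: w₂.reverse := by
      rw [← List.reverse_reverse A₀, hrev]; simp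
    have hcount : A₀.count y = w₁.reverse.count y + 1 := by
      rw [hA₀, List.count_append, List.count_cons_self,
        List.count_eq_zero.2 (mt List.mem_reverse.1 hw₂)]
    have h₀' : c (w₁.reverse ++ y :: w₂.reverse) C₀ ≠ 0 := hA₀ ▸ h₀
    obtain ⟨A', B', hle, hne⟩ := exists_split_sum_ne_zero (fun w₁ w₂ => c (w₁ ++ y :: w₂) C₀) c
      (finite_splits (finite_left hc C₀) y) hc (fun w _ => w.count y) (by simp) h₀' h₀
    rw [h A' B' C₀] at hne
    obtain ⟨i, -, hi⟩ := Finset.exists_ne_zero_of_sum_ne_zero hne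
    obtain ⟨j, -, hj⟩ := Finset.exists_ne_zero_of_sum_ne_zero hi
    have := hmax (_, _) (left_ne_zero_of_mul hj)
    simp only at this hle
    omega
  · rw [List.count_eq_zero.2 hy]; exact Nat.zero_le _

theorem SplitEquation.count_right_le_one {y : X} (h : SplitEquation y c)
    (hc : {p : List X × List X | c p.1 p.2 ≠ 0}.Finite) {A C : List X} (hAC : c A C ≠ 0) :
    C.count y ≤ 1 := by
  obtain ⟨⟨A₀, C₀⟩, h₀, hmax⟩ := Set.exists_max_image _
    (fun p : List X × List X => p.2.count y) hc ⟨(A, C), hAC⟩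
  refine (hmax (A, C) hAC).trans ?_
  simp only at hmax ⊢
  by_cases hy : y ∈ C₀
  -- The mirror argument: the cut is at the first `y`, and the two sides of the equation exchange
  -- roles.
  · obtain ⟨w₁, w₂, hC₀, hw₁⟩ := List.eq_append_cons_of_mem hy
    have hcount : C₀.count y = w₂.count y + 1 := by
      rw [hC₀, List.count_append, List.count_cons_self, List.count_eq_zero.2 hw₁, zero_add]
    have h₀' : c A₀ (w₁ ++ y :: w₂) ≠ 0 := hC₀ ▸ h₀
    obtain ⟨B', C', hle, hne⟩ := exists_split_sum_ne_zero (fun w₁ w₂ => c A₀ (w₁ ++ y :: w₂)) c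
      (finite_splits (finite_right hc A₀) y) hc (fun _ w => w.count y)
      (by simp [add_comm]) h₀' h₀
    rw [← h A₀ B' C'] at hne
    obtain ⟨i, -, hi⟩ := Finset.exists_ne_zero_of_sum_ne_zero hne
    obtain ⟨j, -, hj⟩ := Finset.exists_ne_zero_of_sum_ne_zero hi
    have := hmax (_, _) (left_ne_zero_of_mul hj)
    simp only at this hle
    omega
  · rw [List.count_eq_zero.2 hy]; exact Nat.zero_le _

theorem list_cases_of_count_le_one {x y : X} {l : List X} (hl : ∀ z ∈ l, z = x ∨ z = y)
    (hx : l.count x ≤ 1) (hy : l.count y ≤ 1) :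
    l = [] ∨ l = [x] ∨ l = [y] ∨ l = [x, y] ∨ l = [y, x] := by
  match l with
  | [] => simp
  | [a] => rcases hl a (by simp) with rfl | rfl <;> simp
  | [a, b] =>
    rcases hl a (by simp) with rfl | rfl <;> rcases hl b (by simp) with rfl | rfl <;>
      simp_all
  | a :: b :: d :: l =>
    exfalso
    rcases hl a (by simp) with rfl | rfl <;> rcases hl b (by simp) with rfl | rfl <;>
      rcases hl d (by simp) with rfl | rfl <;> simp [List.count_cons] at hx hy <;>
      split_ifs at hx hy <;> simp_all

end LeadingTerms

/-! ### The quadratic equation on a small support -/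

section SmallSupport

variable {K : Type*} [Field K] {X : Type*} {c : List X → List X → K} {x y : X}

theorem SplitEquation.left_xy_eq_zero (h : SplitEquation y c) (hxy : x ≠ y)
    (hl : ∀ A C, c A C ≠ 0 → A = [] ∨ A = [x] ∨ A = [y] ∨ A = [x, y] ∨ A = [y, x])
    (C : List X) : c [x, y] C = 0 := by
  have hz : ∀ A C, ¬ (A = [] ∨ A = [x] ∨ A = [y] ∨ A = [x, y] ∨ A = [y, x]) → c A C = 0 :=
    fun A C hA => by_contra fun hne => hA (hl A C hne)
  -- This degree is chosen so that the right side vanishes and a single cut survives on the left,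
  -- giving the square of `c [x, y] C`.
  have h1 := h [x, x, y] C C
  have hR : ∀ D, c [x, x, y] D = 0 := fun D => hz _ _ (by simp)
  simp only [hR, zero_mul, Finset.sum_const_zero] at h1
  rw [Finset.sum_eq_single 1, Finset.sum_eq_single C.length] at h1
  · simpa using h1
  · intro j hj hne
    have : C.drop j ≠ [] := by
      simp only [Finset.mem_range] at hj
      rw [Ne, List.drop_eq_nil_iff]; omega
    rw [hz, zero_mul]
    simp [this]
  · simp
  · intro i hi hne
    refine Finset.sum_eq_zero fun j _ => ?_
    simp only [List.length_cons, List.length_nil, Finset.mem_range] at hi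
    interval_cases i
    · simp [hR]
    · exact absurd rfl hne
    · rw [hz, zero_mul]; simp [hxy]
    · rw [hz, zero_mul]; simp [hxy]
  · simp

/-- The quadratic equation for coefficients supported on `{1, x, y, yx} ⊗ {1, x, y, xy}`. -/
theorem SplitEquation.reduced (h : SplitEquation y c) (hxy : x ≠ y)
    (hl : ∀ A C, c A C ≠ 0 → A = [] ∨ A = [x] ∨ A = [y] ∨ A = [y, x])
    (hr : ∀ A C, c A C ≠ 0 → C = [] ∨ C = [x] ∨ C = [y] ∨ C = [x, y]) (A B C : List X) :
    ∑ j ∈ Finset.range (B.length + 1), c (y :: B.drop j) C * c A (B.take j) =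
      ∑ i ∈ Finset.range (B.length + 1), c A (B.take i ++ [y]) * c (B.drop i) C := by
  have hzl : ∀ A C, ¬ (A = [] ∨ A = [x] ∨ A = [y] ∨ A = [y, x]) → c A C = 0 :=
    fun A C hA => by_contra fun hne => hA (hl A C hne)
  have hzr : ∀ A C, ¬ (C = [] ∨ C = [x] ∨ C = [y] ∨ C = [x, y]) → c A C = 0 :=
    fun A C hA => by_contra fun hne => hA (hr A C hne)
  have h1 := h A B C
  -- In the support, `y` can only open a left word and only close a right word. This leaves the cut
  -- `i = 0` on the left side and `j = C.length` on the right side.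
  rw [Finset.sum_eq_single 0] at h1
  · simp only [List.take_zero, List.drop_zero, List.nil_append] at h1
    rw [h1]
    refine Finset.sum_congr rfl fun i _ => ?_
    rw [Finset.sum_eq_single C.length]
    · simp
    · intro j hj hne
      have : C.drop j ≠ [] := by
        simp only [Finset.mem_range] at hj
        rw [Ne, List.drop_eq_nil_iff]; omega
      obtain ⟨z, l, hzl⟩ := List.exists_cons_of_ne_nil this
      rw [hzr, zero_mul]
      rw [hzl]
      rcases B.take i with _ | ⟨p, _ | ⟨q, w⟩⟩ <;> simp [hxy.symm]
    · simp
  · intro i hi hne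
    refine Finset.sum_eq_zero fun j _ => ?_
    rw [hzl, zero_mul]
    cases A with
    | nil => simp at hi; exact absurd hi hne
    | cons p A =>
      obtain ⟨i, rfl⟩ := Nat.exists_eq_succ_of_ne_zero hne
      rcases hA : A.take i with _ | ⟨q, w⟩ <;> simp [hA, hxy.symm]
  · simp

/-- These are the reduced equations for `B = xx`, `x` and `1`. They are two-by-two minor relations,
apart from the middle one, which mixes two minors. -/
theorem SplitEquation.relations (h : SplitEquation y c) (hxy : x ≠ y)
    (hl : ∀ A C, c A C ≠ 0 → A = [] ∨ A = [x] ∨ A = [y] ∨ A = [y, x])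
    (hr : ∀ A C, c A C ≠ 0 → C = [] ∨ C = [x] ∨ C = [y] ∨ C = [x, y]) (A C : List X) :
    c A [x] * c [y, x] C = c A [x, y] * c [x] C ∧
    c A [x] * c [y] C + c A [] * c [y, x] C = c A [y] * c [x] C + c A [x, y] * c [] C ∧
    c A [] * c [y] C = c A [y] * c [] C := by
  have hzl : ∀ A C, ¬ (A = [] ∨ A = [x] ∨ A = [y] ∨ A = [y, x]) → c A C = 0 :=
    fun A C hA => by_contra fun hne => hA (hl A C hne)
  have hzr : ∀ A C, ¬ (C = [] ∨ C = [x] ∨ C = [y] ∨ C = [x, y]) → c A C = 0 :=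
    fun A C hA => by_contra fun hne => hA (hr A C hne)
  have h2 := h.reduced hxy hl hr A [x, x] C
  have h1 := h.reduced hxy hl hr A [x] C
  have h0 := h.reduced hxy hl hr A [] C
  have e1 : c [y, x, x] C = 0 := hzl _ _ (by simp)
  have e2 : c A [x, x] = 0 := hzr _ _ (by simp [hxy])
  have e3 : c [x, x] C = 0 := hzl _ _ (by simp [hxy])
  have e4 : c A [x, x, y] = 0 := hzr _ _ (by simp)
  simp only [List.length_cons, List.length_nil, Finset.sum_range_succ, Finset.range_one,
    Finset.sum_singleton, List.drop_zero, List.take_zero, List.drop_succ_cons, List.take_succ_cons,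
    List.nil_append, List.cons_append, List.drop_nil, zero_add, e1, e2, e3, e4, zero_mul, mul_zero, add_zero] at h0 h1 h2
  refine ⟨?_, ?_, ?_⟩
  · linear_combination h2
  · linear_combination h1
  · linear_combination h0

end SmallSupport

/-! ### Solving the equations: coefficient matrices of rank at most one -/

section Forms

variable {K : Type*} [Field K] {X : Type*}

/-- The affine element `s y + t x + r`. -/
def affineForm (x y : X) (r s t : K) : FreeAlgebra K X :=
  s • FreeAlgebra.ι K y + t • FreeAlgebra.ι K x + r • 1

/-- The element `y x + s y + t x + r`. -/
def quadForm (x y : X) (r s t : K) : FreeAlgebra K X :=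
  FreeAlgebra.ι K y * FreeAlgebra.ι K x + affineForm x y r s t

/-- The element `x y + s y + t x + r`. -/
def quadForm' (x y : X) (r s t : K) : FreeAlgebra K X :=
  FreeAlgebra.ι K x * FreeAlgebra.ι K y + affineForm x y r s t

variable [DecidableEq X]

theorem wcoef_affineForm (x y : X) (r s t : K) (A : List X) :
    wcoef A (affineForm x y r s t) = s * (if [y] = A then 1 else 0)
      + t * (if [x] = A then 1 else 0) + r * (if [] = A then 1 else 0) := by
  have h : affineForm x y r s t = s • word K [y] + t • word K [x] + r • word K [] := by
    simp [affineForm, word]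
  simp only [h, map_add, map_smul, wcoef_word, smul_eq_mul]

theorem wcoef_ι_mul_ι (x y : X) (A : List X) :
    wcoef A (FreeAlgebra.ι K x * FreeAlgebra.ι K y) = if [x, y] = A then 1 else 0 := by
  have h : FreeAlgebra.ι K x * FreeAlgebra.ι K y = word K [x, y] := by simp [word]
  rw [h, wcoef_word]

theorem wcoef_quadForm (x y : X) (r s t : K) (A : List X) :
    wcoef A (quadForm x y r s t) = (if [y, x] = A then 1 else 0) +
      (s * (if [y] = A then 1 else 0) + t * (if [x] = A then 1 else 0)
        + r * (if [] = A then 1 else 0)) := by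
  rw [quadForm, map_add, wcoef_ι_mul_ι, wcoef_affineForm]

theorem wcoef_quadForm' (x y : X) (r s t : K) (A : List X) :
    wcoef A (quadForm' x y r s t) = (if [x, y] = A then 1 else 0) +
      (s * (if [y] = A then 1 else 0) + t * (if [x] = A then 1 else 0)
        + r * (if [] = A then 1 else 0)) := by
  rw [quadForm', map_add, wcoef_ι_mul_ι, wcoef_affineForm]

/-- The solutions of the two quadratic equations with small support. -/
theorem forms_of_splitEquation {x y : X} (hxy : x ≠ y)
    (g : FreeAlgebra K X ⊗[K] FreeAlgebra K X)
    (hy : SplitEquation y fun A C => wcoef₂ A C g)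
    (hx : SplitEquation x fun A C => wcoef₂ C A g)
    (hl : ∀ A C, wcoef₂ A C g ≠ 0 →
      A = [] ∨ A = [x] ∨ A = [y] ∨ A = [x, y] ∨ A = [y, x])
    (hr : ∀ A C, wcoef₂ A C g ≠ 0 →
      C = [] ∨ C = [x] ∨ C = [y] ∨ C = [x, y] ∨ C = [y, x]) :
    (∃ a r s t : K, g = a • (affineForm x y r s t ⊗ₜ[K] affineForm x y r s t)) ∨
    (∃ a r s t : K, a ≠ 0 ∧ g = a • (quadForm x y r s t ⊗ₜ[K] quadForm' x y r s t)) := by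
  generalize hc : (fun A C => wcoef₂ A C g) = c at hy
  have hc' : ∀ A C, wcoef₂ A C g = c A C := fun A C => by rw [← hc]
  simp only [hc'] at hx hl hr
  have hl' : ∀ A C, c A C ≠ 0 → A = [] ∨ A = [x] ∨ A = [y] ∨ A = [y, x] := by
    intro A C h
    rcases hl A C h with h' | h' | h' | h' | h'
    · simp [h']
    · simp [h']
    · simp [h']
    · exact absurd (by rw [h', hy.left_xy_eq_zero hxy hl]) h
    · simp [h']
  have hr' : ∀ A C, c A C ≠ 0 → C = [] ∨ C = [x] ∨ C = [y] ∨ C = [x, y] := by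
    intro A C h
    rcases hr A C h with h' | h' | h' | h' | h'
    · simp [h']
    · simp [h']
    · simp [h']
    · simp [h']
    · refine absurd ?_ h
      rw [h']
      exact hx.left_xy_eq_zero hxy.symm
        (fun A C h => by have := hr C A h; tauto) A
  have rel := hy.relations hxy hl' hr'
  have rel' := hx.relations hxy.symm
    (fun A C h => by have := hr' C A h; tauto) (fun A C h => by have := hl' C A h; tauto)
  have ra : ∀ A C, c A [x] * c [y, x] C = c A [x, y] * c [x] C := fun A C => (rel A C).1
  have rb : ∀ A C, c A [x] * c [y] C + c A [] * c [y, x] C =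
    c A [y] * c [x] C + c A [x, y] * c [] C := fun A C => (rel A C).2.1
  have rc : ∀ A C, c A [] * c [y] C = c A [y] * c [] C := fun A C => (rel A C).2.2
  have ra' : ∀ A C, c A [y] * c [y, x] C = c A [x, y] * c [y] C := fun A C => by
    have := (rel' C A).1; linear_combination -this
  have rc' : ∀ A C, c A [] * c [x] C = c A [x] * c [] C := fun A C => by
    have := (rel' C A).2.2; linear_combination -this
  have hzl : ∀ A C, ¬ (A = [] ∨ A = [x] ∨ A = [y] ∨ A = [y, x]) → c A C = 0 :=
    fun A C hA => by_contra fun hne => hA (hl' A C hne)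
  have hzr : ∀ A C, ¬ (C = [] ∨ C = [x] ∨ C = [y] ∨ C = [x, y]) → c A C = 0 :=
    fun A C hA => by_contra fun hne => hA (hr' A C hne)
  -- The coefficient of `yx ⊗ xy` separates the affine from the quadratic solutions.
  by_cases h33 : c [y, x] [x, y] = 0
  · left
    -- With the corner zero, a nonzero entry `c [y, x] C₀` can be cancelled from the relations with
    -- `A = [y, x]`. This kills the entries of that row one after another, including `c [y, x] C₀`
    -- itself.
    have row : ∀ C, c [y, x] C = 0 := by
      intro C₀
      by_contra h0
      have h1 : c [y, x] [x] = 0 := by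
        have := ra [y, x] C₀
        rw [h33, zero_mul] at this
        exact (mul_eq_zero.1 this).resolve_right h0
      have h2 : c [y, x] [y] = 0 := by
        have := ra' [y, x] C₀
        rw [h33, zero_mul] at this
        exact (mul_eq_zero.1 this).resolve_right h0
      have h3 : c [y, x] [] = 0 := by
        have := rb [y, x] C₀
        rw [h33, h1, h2, zero_mul, zero_mul, zero_mul, zero_add, zero_add] at this
        exact (mul_eq_zero.1 this).resolve_right h0
      rcases hr' _ _ h0 with h | h | h | h <;> rw [h] at h0 <;> contradiction
    have col : ∀ A, c A [x, y] = 0 := by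
      intro A₀
      by_contra h0
      have h1 : c [x] [x, y] = 0 := by
        have := ra A₀ [x, y]
        rw [h33, mul_zero, eq_comm] at this
        exact (mul_eq_zero.1 this).resolve_left h0
      have h2 : c [y] [x, y] = 0 := by
        have := ra' A₀ [x, y]
        rw [h33, mul_zero, eq_comm] at this
        exact (mul_eq_zero.1 this).resolve_left h0
      have h3 : c [] [x, y] = 0 := by
        have := rb A₀ [x, y]
        rw [h33, h1, h2, mul_zero, mul_zero, mul_zero, zero_add, zero_add, eq_comm] at this
        exact (mul_eq_zero.1 this).resolve_left h0
      rcases hl' _ _ h0 with h | h | h | h <;> rw [h] at h0 <;> contradiction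
    have hT : ∀ A C, c A C ≠ 0 → (A = [] ∨ A = [x] ∨ A = [y]) ∧ (C = [] ∨ C = [x] ∨ C = [y]) := by
      intro A C h
      constructor
      · rcases hl' _ _ h with h' | h' | h' | h'
        · simp [h']
        · simp [h']
        · simp [h']
        · exact absurd (by rw [h', row]) h
      · rcases hr' _ _ h with h' | h' | h' | h'
        · simp [h']
        · simp [h']
        · simp [h']
        · exact absurd (by rw [h', col]) h
    -- On the remaining block indexed by `1, x, y`, the mixed relation loses its quadratic terms,
    -- and exchanging the two inner indices becomes always possible.
    have sym : ∀ i j, (i = [] ∨ i = [x] ∨ i = [y]) → (j = [] ∨ j = [x] ∨ j = [y]) →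
        ∀ A C, c A i * c j C = c A j * c i C := by
      have rb' : ∀ A C, c A [x] * c [y] C = c A [y] * c [x] C := fun A C => by
        have := rb A C
        rwa [row, col, mul_zero, zero_mul, add_zero, add_zero] at this
      rintro i j (rfl | rfl | rfl) (rfl | rfl | rfl) A C
      · rfl
      · exact rc' A C
      · exact rc A C
      · exact (rc' A C).symm
      · rfl
      · exact rb' A C
      · exact (rc A C).symm
      · exact (rb' A C).symm
      · rfl
    -- A nonzero diagonal entry `c i i` makes the block symmetric of rank one, with the ratios `c i
    -- j / c i i` as the coefficients of `w`.
    by_cases hdiag : ∃ i, c i i ≠ 0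
    · obtain ⟨i, hi⟩ := hdiag
      have hiT := (hT i i hi).1
      have fac : ∀ j l, (j = [] ∨ j = [x] ∨ j = [y]) → (l = [] ∨ l = [x] ∨ l = [y]) →
          c j l = c i i * (c i j / c i i) * (c i l / c i i) := by
        intro j l hj hl
        have e1 := sym i j hiT hj i i
        have e2 := sym i l hiT hl i i
        have e3 := sym i l hiT hl j i
        have e4 : c j i = c i j := mul_left_cancel₀ hi (by rw [e1, mul_comm])
        have e5 : c l i = c i l := mul_left_cancel₀ hi (by rw [e2, mul_comm])
        rw [e4, e5] at e3
        field_simp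
        exact e3.symm
      refine ⟨c i i, c i [] / c i i, c i [y] / c i i, c i [x] / c i i, ext_wcoef₂ fun A C => ?_⟩
      rw [hc', map_smul, wcoef₂_tmul, wcoef_affineForm, wcoef_affineForm, smul_eq_mul]
      by_cases hA : A = [] ∨ A = [x] ∨ A = [y]
      · by_cases hC : C = [] ∨ C = [x] ∨ C = [y]
        · rw [fac A C hA hC]
          rcases hA with rfl | rfl | rfl <;> rcases hC with rfl | rfl | rfl <;>
            simp [hxy, hxy.symm, mul_assoc]
        · have : c A C = 0 := by_contra fun h => hC (hT _ _ h).2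
          simp only [not_or] at hC
          rw [this, if_neg (Ne.symm hC.2.2), if_neg (Ne.symm hC.2.1), if_neg (Ne.symm hC.1)]
          simp
      · have : c A C = 0 := by_contra fun h => hA (hT _ _ h).1
        simp only [not_or] at hA
        rw [this, if_neg (Ne.symm hA.2.2), if_neg (Ne.symm hA.2.1), if_neg (Ne.symm hA.1)]
        simp
    · push Not at hdiag
      refine ⟨0, 0, 0, 0, ext_wcoef₂ fun A C => ?_⟩
      rw [hc', zero_smul, map_zero]
      by_contra h
      -- With zero diagonal, `(c A C)² = c A A * c C C = 0`, so `g = 0`.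
      have e := sym C A (hT _ _ h).2 (hT _ _ h).1 A C
      rw [hdiag, hdiag, zero_mul] at e
      exact h (mul_self_eq_zero.1 e)
  · right
    -- When the corner is nonzero, every row is a multiple of the row of `yx` and every column a
    -- multiple of the column of `xy`. The identities `e1`, `e2`, `e3` show that the multipliers for
    -- rows and columns coincide, so one triple `r, s, t` serves both tensor factors.
    have e1 : c [y, x] [x] = c [x] [x, y] :=
      mul_right_cancel₀ h33 ((ra [y, x] [x, y]).trans (mul_comm _ _))
    have e2 : c [y, x] [y] = c [y] [x, y] :=
      mul_right_cancel₀ h33 ((ra' [y, x] [x, y]).trans (mul_comm _ _))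
    have colx : ∀ A, c A [x] = c [x] [x, y] / c [y, x] [x, y] * c A [x, y] := fun A => by
      field_simp; linear_combination ra A [x, y]
    have rowx : ∀ C, c [x] C = c [x] [x, y] / c [y, x] [x, y] * c [y, x] C := fun C => by
      rw [← e1]; field_simp; linear_combination -ra [y, x] C
    have coly : ∀ A, c A [y] = c [y] [x, y] / c [y, x] [x, y] * c A [x, y] := fun A => by
      field_simp; linear_combination ra' A [x, y]
    have rowy : ∀ C, c [y] C = c [y] [x, y] / c [y, x] [x, y] * c [y, x] C := fun C => by
      rw [← e2]; field_simp; linear_combination -ra' [y, x] C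
    have rd : ∀ A C, c A [] * c [y, x] C = c A [x, y] * c [] C := fun A C => by
      have := rb A C
      rw [colx A, coly A, rowx C, rowy C] at this
      linear_combination this
    have e3 : c [y, x] [] = c [] [x, y] :=
      mul_right_cancel₀ h33 ((rd [y, x] [x, y]).trans (mul_comm _ _))
    have col1 : ∀ A, c A [] = c [] [x, y] / c [y, x] [x, y] * c A [x, y] := fun A => by
      field_simp; linear_combination rd A [x, y]
    have row1 : ∀ C, c [] C = c [] [x, y] / c [y, x] [x, y] * c [y, x] C := fun C => by
      rw [← e3]; field_simp; linear_combination -rd [y, x] C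
    generalize c [] [x, y] / c [y, x] [x, y] = r at col1 row1
    generalize c [x] [x, y] / c [y, x] [x, y] = t at colx rowx
    generalize c [y] [x, y] / c [y, x] [x, y] = s at coly rowy
    refine ⟨c [y, x] [x, y], r, s, t, h33, ext_wcoef₂ fun A C => ?_⟩
    rw [hc', map_smul, wcoef₂_tmul, wcoef_quadForm, wcoef_quadForm', smul_eq_mul]
    by_cases hA : A = [] ∨ A = [x] ∨ A = [y] ∨ A = [y, x]
    · by_cases hC : C = [] ∨ C = [x] ∨ C = [y] ∨ C = [x, y]
      · have hrow : c A C = ((if [y, x] = A then 1 else 0) +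
            (s * (if [y] = A then 1 else 0) + t * (if [x] = A then 1 else 0)
              + r * (if [] = A then 1 else 0))) * c [y, x] C := by
          rcases hA with rfl | rfl | rfl | rfl
          · rw [row1]; simp
          · rw [rowx]; simp [hxy.symm]
          · rw [rowy]; simp [hxy]
          · simp
        have hcol : c [y, x] C = ((if [x, y] = C then 1 else 0) +
            (s * (if [y] = C then 1 else 0) + t * (if [x] = C then 1 else 0)
              + r * (if [] = C then 1 else 0))) * c [y, x] [x, y] := by
          rcases hC with rfl | rfl | rfl | rfl
          · rw [col1]; simp
          · rw [colx]; simp [hxy.symm]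
          · rw [coly]; simp [hxy]
          · simp
        rw [hrow, hcol]; ring
      · rw [hzr A C hC]
        simp only [not_or] at hC
        rw [if_neg (Ne.symm hC.2.2.2), if_neg (Ne.symm hC.2.2.1), if_neg (Ne.symm hC.2.1),
          if_neg (Ne.symm hC.1)]
        simp
    · rw [hzl A C hA]
      simp only [not_or] at hA
      rw [if_neg (Ne.symm hA.2.2.2), if_neg (Ne.symm hA.2.2.1), if_neg (Ne.symm hA.2.1),
        if_neg (Ne.symm hA.1)]
      simp

end Forms

/-! ### The Jacobi identity on generators of `R2` -/

section Jacobi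

variable {K : Type*} [Field K] {k : ℤ} {g : R2 K ⊗[K] R2 K}
  {P : R2 K →ₗ[K] R2 K →ₗ[K] R2 K ⊗[K] R2 K}

theorem diagPow_injective (S : R2 K ≃ₐ[K] R2 K) (n : ℤ) {t : R2 K ⊗[K] R2 K}
    (h : diagPow S n t = 0) : t = 0 := by
  rw [← diagPow_zero S t, ← neg_add_cancel n, ← diagPow_diagPow, h, map_zero]

theorem exists_wcoef₂_ne_zero {t : R2 K ⊗[K] R2 K} (h : t ≠ 0) :
    ∃ A B, wcoef₂ A B t ≠ 0 := by
  by_contra! hcon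
  exact h (ext_wcoef₂ fun A B => by rw [hcon, map_zero])

namespace IsMonomialDoubleBracket

theorem u_u (h : IsMonomialDoubleBracket k g P) (i j : ℤ) :
    P (FreeAlgebra.ι K (0, i)) (FreeAlgebra.ι K (0, j)) = 0 := by
  rw [h.ι_ι]; simp [generatorBracket]

theorem v_v (h : IsMonomialDoubleBracket k g P) (i j : ℤ) :
    P (FreeAlgebra.ι K (1, i)) (FreeAlgebra.ι K (1, j)) = 0 := by
  rw [h.ι_ι]; simp [generatorBracket]

theorem u_v (h : IsMonomialDoubleBracket k g P) (i j : ℤ) :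
    P (FreeAlgebra.ι K (0, i)) (FreeAlgebra.ι K (1, j)) =
      if i = j + k then diagPow (shift K) j g else 0 := by
  rw [h.ι_ι]; simp [generatorBracket]

theorem v_u (h : IsMonomialDoubleBracket k g P) (i j : ℤ) :
    P (FreeAlgebra.ι K (1, i)) (FreeAlgebra.ι K (0, j)) =
      if j = i + k then - flip (diagPow (shift K) i g) else 0 := by
  rw [h.ι_ι]; simp [generatorBracket]

theorem jacobiator_u_u_v (h : IsMonomialDoubleBracket k g P) (i i' j : ℤ) :
    jacobiator P (FreeAlgebra.ι K (0, i)) (FreeAlgebra.ι K (0, i')) (FreeAlgebra.ι K (1, j)) =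
      assocMap ((P (FreeAlgebra.ι K (0, i))).rTensor _
        (if i' = j + k then diagPow (shift K) j g else 0)) -
      (P (FreeAlgebra.ι K (0, i'))).lTensor _
        (if i = j + k then diagPow (shift K) j g else 0) := by
  rw [jacobiator_apply, h.u_u, h.u_v, h.u_v, map_zero, map_zero, sub_zero]

theorem jacobiator_v_v_u (h : IsMonomialDoubleBracket k g P) (i i' j : ℤ) :
    jacobiator P (FreeAlgebra.ι K (1, i)) (FreeAlgebra.ι K (1, i')) (FreeAlgebra.ι K (0, j)) =
      assocMap ((P (FreeAlgebra.ι K (1, i))).rTensor _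
        (if j = i' + k then - flip (diagPow (shift K) i' g) else 0)) -
      (P (FreeAlgebra.ι K (1, i'))).lTensor _
        (if j = i + k then - flip (diagPow (shift K) i g) else 0) := by
  rw [jacobiator_apply, h.v_v, h.v_u, h.v_u, map_zero, map_zero, sub_zero]

/-- Every triple mixing both kinds of letters is a rotation of one of the two types in the
hypotheses. On unmixed triples all brackets vanish. -/
theorem jacobiator_ι_eq_zero (h : IsMonomialDoubleBracket k g P)
    (huuv : ∀ i i' j, jacobiator P (FreeAlgebra.ι K (0, i)) (FreeAlgebra.ι K (0, i'))
      (FreeAlgebra.ι K (1, j)) = 0)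
    (hvvu : ∀ i i' j, jacobiator P (FreeAlgebra.ι K (1, i)) (FreeAlgebra.ι K (1, i'))
      (FreeAlgebra.ι K (0, j)) = 0) (p q r : Fin 2 × ℤ) :
    jacobiator P (FreeAlgebra.ι K p) (FreeAlgebra.ι K q) (FreeAlgebra.ι K r) = 0 := by
  have cyc : ∀ a b c, jacobiator P b c a = 0 → jacobiator P a b c = 0 := fun a b c h' => by
    rw [jacobiator_cyclic h.skew, h', map_zero, map_zero]
  have two : ∀ e : Fin 2, e = 0 ∨ e = 1 := by decide
  obtain ⟨e, i⟩ := p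
  obtain ⟨f, j⟩ := q
  obtain ⟨e', l⟩ := r
  rcases two e with rfl | rfl <;> rcases two f with rfl | rfl <;> rcases two e' with rfl | rfl
  · simp [jacobiator_apply, h.u_u]
  · exact huuv _ _ _
  · exact cyc _ _ _ (cyc _ _ _ (huuv _ _ _))
  · exact cyc _ _ _ (hvvu _ _ _)
  · exact cyc _ _ _ (huuv _ _ _)
  · exact cyc _ _ _ (cyc _ _ _ (hvvu _ _ _))
  · exact hvvu _ _ _
  · simp [jacobiator_apply, h.v_v]

/-- The Jacobi identity on generators forces `g` to have one of two shapes. -/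
theorem forms_of_jacobiator (h : IsMonomialDoubleBracket k g P)
    (hJ : ∀ p q r, jacobiator P (FreeAlgebra.ι K p) (FreeAlgebra.ι K q)
      (FreeAlgebra.ι K r) = 0) :
    (∃ a r s t : K, g = a • (affineForm ((0 : Fin 2), k) (1, 0) r s t ⊗ₜ[K]
      affineForm (0, k) (1, 0) r s t)) ∨
    (∃ a r s t : K, a ≠ 0 ∧ g = a • (quadForm ((0 : Fin 2), k) (1, 0) r s t ⊗ₜ[K]
      quadForm' (0, k) (1, 0) r s t)) := by
  by_cases hg : g = 0
  · exact Or.inl ⟨0, 0, 0, 0, by rw [hg, zero_smul]⟩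
  have two : ∀ e : Fin 2, e = 0 ∨ e = 1 := by decide
  have hDu : ∀ i, ∀ x : Fin 2 × ℤ, x ≠ (1, i - k) →
      P (FreeAlgebra.ι K (0, i)) (FreeAlgebra.ι K x) = 0 := by
    rintro i ⟨e, j⟩ hx
    rcases two e with rfl | rfl
    · exact h.u_u i j
    · rw [h.u_v, if_neg]
      rintro rfl; simp at hx
  have hDv : ∀ i, ∀ x : Fin 2 × ℤ, x ≠ (0, i + k) →
      P (FreeAlgebra.ι K (1, i)) (FreeAlgebra.ι K x) = 0 := by
    rintro i ⟨e, j⟩ hx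
    rcases two e with rfl | rfl
    · rw [h.v_u, if_neg]
      rintro rfl; simp at hx
    · exact h.v_v i j
  have hfin := finite_support_wcoef₂ g
  have hfin' : {p : List (Fin 2 × ℤ) × List (Fin 2 × ℤ) | wcoef₂ p.2 p.1 g ≠ 0}.Finite := by
    simpa only [wcoef₂_flip] using finite_support_wcoef₂ (flip g)
  have hDuy : ∀ i, P (FreeAlgebra.ι K (0, i)) (FreeAlgebra.ι K (1, i - k)) =
      diagPow (shift K) (i - k) g := fun i => by rw [h.u_v, if_pos (by ring)]
  have hDvx : ∀ i, P (FreeAlgebra.ι K (1, i)) (FreeAlgebra.ι K (0, i + k)) =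
      - flip (diagPow (shift K) i g) := fun i => by rw [h.v_u, if_pos rfl]
  have hneu : ∀ i, P (FreeAlgebra.ι K (0, i)) (FreeAlgebra.ι K (1, i - k)) ≠ 0 := fun i h0 =>
    hg (diagPow_injective _ _ ((hDuy i).symm.trans h0))
  have hnev : ∀ i, P (FreeAlgebra.ι K (1, i)) (FreeAlgebra.ι K (0, i + k)) ≠ 0 := fun i h0 => by
    rw [hDvx, neg_eq_zero] at h0
    refine hg (diagPow_injective (shift K) i ?_)
    rw [← flip_flip (diagPow (shift K) i g), h0, map_zero]
  have noV : ∀ j, j ≠ 0 → ∀ A C, wcoef₂ A C g ≠ 0 →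
      ((1 : Fin 2), j) ∉ A ∧ ((1 : Fin 2), j) ∉ C := by
    intro j hj A C hAC
    have hij : j + k ≠ 0 + k := by simpa using hj
    have hk : j + k - k = j := by ring
    constructor
    · refine not_mem_left_of_split_sum_eq_zero (γ := fun α β => wcoef₂ α β _)
        (c := fun A C => wcoef₂ A C g) hfin
        (finite_support_wcoef₂ (P (FreeAlgebra.ι K (0, j + k)) (FreeAlgebra.ι K (1, j + k - k))))
        (exists_wcoef₂_ne_zero (hneu _)) (1, j) (fun A B C => ?_) hAC
      have := hJ (0, j + k) (0, k) (1, 0)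
      rw [h.jacobiator_u_u_v, if_pos (by ring), if_neg hij, map_zero, sub_zero, diagPow_zero]
        at this
      have h2 := congrArg (wcoef₃ A B C) this
      rw [wcoef₃_derivation_left _ (h.isDoubleBracket.left _) _ (hDu (j + k)), map_zero] at h2
      simpa only [hk] using h2
    · refine not_mem_right_of_split_sum_eq_zero (γ := fun α β => wcoef₂ α β _)
        (c := fun A C => wcoef₂ A C g) hfin
        (finite_support_wcoef₂ (P (FreeAlgebra.ι K (0, j + k)) (FreeAlgebra.ι K (1, j + k - k))))
        (exists_wcoef₂_ne_zero (hneu _)) (1, j) (fun A B C => ?_) hAC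
      have := hJ (0, k) (0, j + k) (1, 0)
      rw [h.jacobiator_u_u_v, if_neg hij, if_pos (by ring), map_zero, map_zero, zero_sub,
        neg_eq_zero, diagPow_zero] at this
      have h2 := congrArg (wcoef₃ A B C) this
      rw [wcoef₃_derivation_right _ (h.isDoubleBracket.left _) _ (hDu (j + k)), map_zero] at h2
      simpa only [hk] using h2
  have noU : ∀ i, i ≠ k → ∀ A C, wcoef₂ A C g ≠ 0 →
      ((0 : Fin 2), i) ∉ A ∧ ((0 : Fin 2), i) ∉ C := by
    intro i hi A C hAC
    have hij : ¬ k = i - k + k := fun h' => hi (by omega)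
    have hk : i - k + k = i := by ring
    constructor
    · refine not_mem_right_of_split_sum_eq_zero (γ := fun α β => wcoef₂ α β _)
        (c := fun A C => wcoef₂ C A g) hfin'
        (finite_support_wcoef₂ (P (FreeAlgebra.ι K (1, i - k)) (FreeAlgebra.ι K (0, i - k + k))))
        (exists_wcoef₂_ne_zero (hnev _)) (0, i) (fun A B C => ?_) hAC
      have := hJ (1, 0) (1, i - k) (0, k)
      rw [h.jacobiator_v_v_u, if_neg hij, if_pos (by ring), map_zero, map_zero, zero_sub,
        neg_eq_zero, diagPow_zero, map_neg, neg_eq_zero] at this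
      have h2 := congrArg (wcoef₃ A B C) this
      rw [wcoef₃_derivation_right _ (h.isDoubleBracket.left _) _ (hDv (i - k)), map_zero] at h2
      simpa only [hk, wcoef₂_flip] using h2
    · refine not_mem_left_of_split_sum_eq_zero (γ := fun α β => wcoef₂ α β _)
        (c := fun A C => wcoef₂ C A g) hfin'
        (finite_support_wcoef₂ (P (FreeAlgebra.ι K (1, i - k)) (FreeAlgebra.ι K (0, i - k + k))))
        (exists_wcoef₂_ne_zero (hnev _)) (0, i) (fun A B C => ?_) hAC
      have := hJ (1, i - k) (1, 0) (0, k)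
      rw [h.jacobiator_v_v_u, if_pos (by ring), if_neg hij, map_zero, sub_zero, diagPow_zero,
        map_neg, map_neg, neg_eq_zero] at this
      have h2 := congrArg (wcoef₃ A B C) this
      rw [wcoef₃_derivation_left _ (h.isDoubleBracket.left _) _ (hDv (i - k)), map_zero] at h2
      simpa only [hk, wcoef₂_flip] using h2
  have hy : SplitEquation ((1 : Fin 2), (0 : ℤ)) fun A C => wcoef₂ A C g := by
    intro A B C
    have := hJ (0, k) (0, k) (1, 0)
    rw [h.jacobiator_u_u_v, if_pos (by ring), diagPow_zero, sub_eq_zero] at this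
    have h2 := congrArg (wcoef₃ A B C) this
    rw [wcoef₃_derivation_left _ (h.isDoubleBracket.left _) _ (hDu k),
      wcoef₃_derivation_right _ (h.isDoubleBracket.left _) _ (hDu k), hDuy] at h2
    simpa only [sub_self, diagPow_zero] using h2
  -- Here `-flip g` replaces `g`, both as the element differentiated and as the value of the
  -- derivation. The signs cancel, and the left and right words are exchanged.
  have hx : SplitEquation ((0 : Fin 2), k) fun A C => wcoef₂ C A g := by
    intro A B C
    have := hJ (1, 0) (1, 0) (0, k)
    rw [h.jacobiator_v_v_u, if_pos (by ring), diagPow_zero, map_neg, map_neg, map_neg,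
      sub_eq_zero, neg_inj] at this
    have h2 := congrArg (wcoef₃ A B C) this
    rw [wcoef₃_derivation_left _ (h.isDoubleBracket.left _) _ (hDv 0),
      wcoef₃_derivation_right _ (h.isDoubleBracket.left _) _ (hDv 0), hDvx] at h2
    simpa only [zero_add, diagPow_zero, wcoef₂_flip, map_neg, mul_neg, Finset.sum_neg_distrib,
      neg_inj] using h2
  have letters : ∀ A C, wcoef₂ A C g ≠ 0 →
      (∀ z ∈ A, z = ((0 : Fin 2), k) ∨ z = (1, 0)) ∧
      (∀ z ∈ C, z = ((0 : Fin 2), k) ∨ z = (1, 0)) := by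
    intro A C hAC
    constructor <;> rintro ⟨e, i⟩ hz <;> rcases two e with rfl | rfl
    · by_cases hi : i = k
      · simp [hi]
      · exact absurd hz (noU i hi A C hAC).1
    · by_cases hi : i = 0
      · simp [hi]
      · exact absurd hz (noV i hi A C hAC).1
    · by_cases hi : i = k
      · simp [hi]
      · exact absurd hz (noU i hi A C hAC).2
    · by_cases hi : i = 0
      · simp [hi]
      · exact absurd hz (noV i hi A C hAC).2
  exact forms_of_splitEquation (by simp) g hy hx
    (fun A C hAC => list_cases_of_count_le_one (letters A C hAC).1
      (hx.count_right_le_one hfin' hAC) (hy.count_left_le_one hfin hAC))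
    (fun A C hAC => list_cases_of_count_le_one (letters A C hAC).2
      (hx.count_left_le_one hfin' hAC) (hy.count_right_le_one hfin hAC))

/-- Sufficient conditions for the Jacobi identity when `g` is a pure tensor. -/
theorem jacobiator_eq_zero_of_pure (h : IsMonomialDoubleBracket k g P) (a : K)
    (p q m n : ℤ → R2 K) (hg : ∀ j, diagPow (shift K) j g = a • (p j ⊗ₜ[K] q j))
    (hup : ∀ i j, P (FreeAlgebra.ι K (0, i)) (p j) =
      outerRight (m j) (P (FreeAlgebra.ι K (0, i)) (FreeAlgebra.ι K (1, j))))
    (huq : ∀ i j, P (FreeAlgebra.ι K (0, i)) (q j) =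
      outerLeft (m j) (P (FreeAlgebra.ι K (0, i)) (FreeAlgebra.ι K (1, j))))
    (hvq : ∀ i j, P (FreeAlgebra.ι K (1, i)) (q j) =
      outerRight (n j) (P (FreeAlgebra.ι K (1, i)) (FreeAlgebra.ι K (0, j + k))))
    (hvp : ∀ i j, P (FreeAlgebra.ι K (1, i)) (p j) =
      outerLeft (n j) (P (FreeAlgebra.ι K (1, i)) (FreeAlgebra.ι K (0, j + k))))
    (hm : ∀ j, q j * m j = m j * p j) (hn : ∀ j, p j * n j = n j * q j) (x y z : Fin 2 × ℤ) :
    jacobiator P (FreeAlgebra.ι K x) (FreeAlgebra.ι K y) (FreeAlgebra.ι K z) = 0 := by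
  refine h.jacobiator_ι_eq_zero (fun i i' j => ?_) (fun i i' j => ?_) x y z
  -- `m` plays the role of the cofactor of `v` in `p` and `q`. When both terms are present they are
  -- multiples, by the same scalar `a²`, of `p ⊗ q m ⊗ q` and `p ⊗ m p ⊗ q`, so `q m = m p` is what
  -- is needed. For `(v, v, u)` the cofactor `n` of `u` gives `p n = n q` in the same way.
  · rw [h.jacobiator_u_u_v]
    by_cases h1 : i = j + k <;> by_cases h2 : i' = j + k
    · subst h1; subst h2
      simp only [if_true, hg, map_smul, LinearMap.rTensor_tmul, LinearMap.lTensor_tmul, hup, huq,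
        h.u_v, outerRight_tmul, outerLeft_tmul, hm]
      simp [← TensorProduct.smul_tmul']
    · rw [if_pos h1, if_neg h2, map_zero, map_zero, hg, map_smul, LinearMap.lTensor_tmul, huq,
        h.u_v, if_neg h2]
      simp
    · rw [if_neg h1, if_pos h2, map_zero, hg, map_smul, LinearMap.rTensor_tmul, hup,
        h.u_v, if_neg h1]
      simp
    · simp [h1, h2]
  · rw [h.jacobiator_v_v_u]
    by_cases h1 : j = i + k <;> by_cases h2 : j = i' + k
    · obtain rfl : i = i' := by omega
      subst h1
      simp only [if_true, hg, map_neg, map_smul, flip_tmul, LinearMap.rTensor_tmul,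
        LinearMap.lTensor_tmul, hvp, hvq, h.v_u, outerRight_tmul, outerLeft_tmul, hn]
      simp [← TensorProduct.smul_tmul', TensorProduct.neg_tmul, TensorProduct.tmul_neg]
    · have h3 : ¬ i + k = i' + k := fun h' => h2 (h1.trans h')
      rw [if_pos h1, if_neg h2, map_zero, map_zero, hg, map_smul, flip_tmul, map_neg, map_smul,
        LinearMap.lTensor_tmul, hvp, h.v_u, if_neg h3]
      simp
    · have h3 : ¬ i' + k = i + k := fun h' => h1 (h2.trans h')
      rw [if_neg h1, if_pos h2, map_zero, hg, map_smul, flip_tmul, map_neg, map_smul,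
        LinearMap.rTensor_tmul, hvq, h.v_u, if_neg h3]
      simp
    · simp [h1, h2]

theorem shift_zpow_affineForm (i j : ℤ) (x y : Fin 2) (i' : ℤ) (r s t : K) :
    (shift K ^ j) (affineForm (x, i) (y, i') r s t) =
      affineForm (x, i + j) (y, i' + j) r s t := by
  simp [affineForm, shift_zpow_ι]

theorem map_one_right (h : IsMonomialDoubleBracket k g P) (a : R2 K) : P a 1 = 0 := by
  simpa using h.isDoubleBracket.left a 1 1

/-- The cofactors of `v` and `u` are the scalars `s` and `t`, and `p = q`, so the commutation
conditions are trivial. -/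
theorem jacobiator_affineForm {a r s t : K}
    (h : IsMonomialDoubleBracket k (a • (affineForm ((0 : Fin 2), k) (1, 0) r s t ⊗ₜ[K]
      affineForm (0, k) (1, 0) r s t)) P) (x y z : Fin 2 × ℤ) :
    jacobiator P (FreeAlgebra.ι K x) (FreeAlgebra.ι K y) (FreeAlgebra.ι K z) = 0 := by
  have eR : ∀ (b : K) (T : R2 K ⊗[K] R2 K), outerRight (b • 1) T = b • T := by
    intro b T
    induction T using TensorProduct.induction_on with
    | zero => simp
    | add x y hx hy => simp only [map_add, hx, hy, smul_add]
    | tmul x y => simp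
  have eL : ∀ (b : K) (T : R2 K ⊗[K] R2 K), outerLeft (b • 1) T = b • T := by
    intro b T
    induction T using TensorProduct.induction_on with
    | zero => simp
    | add x y hx hy => simp only [map_add, hx, hy, smul_add]
    | tmul x y => simp [← TensorProduct.smul_tmul']
  refine h.jacobiator_eq_zero_of_pure a (fun j => affineForm (0, j + k) (1, j) r s t)
    (fun j => affineForm (0, j + k) (1, j) r s t) (fun _ => s • 1) (fun _ => t • 1)
    (fun j => ?_) (fun i j => ?_) (fun i j => ?_) (fun i j => ?_) (fun i j => ?_)
    (fun j => by simp) (fun j => by simp) x y z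
  · rw [map_smul, diagPow_tmul, shift_zpow_affineForm, zero_add, add_comm k]
  · simp [affineForm, h.u_u, h.map_one_right, eR]
  · simp [affineForm, h.u_u, h.map_one_right, eL]
  · simp [affineForm, h.v_v, h.map_one_right, eR]
  · simp [affineForm, h.v_v, h.map_one_right, eL]

/-- With cofactors `m = u + s` and `n = v + t` one has `p = n m + (r - s t)` and `q = m n + (r - s
t)`. Hence `q m = m p` and `p n = n q`. -/
theorem jacobiator_quadForm {a r s t : K}
    (h : IsMonomialDoubleBracket k (a • (quadForm ((0 : Fin 2), k) (1, 0) r s t ⊗ₜ[K]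
      quadForm' (0, k) (1, 0) r s t)) P) (x y z : Fin 2 × ℤ) :
    jacobiator P (FreeAlgebra.ι K x) (FreeAlgebra.ι K y) (FreeAlgebra.ι K z) = 0 := by
  have eR : ∀ (b : K) (c : R2 K) (T : R2 K ⊗[K] R2 K),
      outerRight (c + b • 1) T = outerRight c T + b • T := by
    intro b c T
    induction T using TensorProduct.induction_on with
    | zero => simp
    | add x y hx hy => simp only [map_add, hx, hy, smul_add]; abel
    | tmul x y => simp [mul_add, TensorProduct.tmul_add]
  have eL : ∀ (b : K) (c : R2 K) (T : R2 K ⊗[K] R2 K),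
      outerLeft (c + b • 1) T = outerLeft c T + b • T := by
    intro b c T
    induction T using TensorProduct.induction_on with
    | zero => simp
    | add x y hx hy => simp only [map_add, hx, hy, smul_add]; abel
    | tmul x y => simp [add_mul, TensorProduct.add_tmul, ← TensorProduct.smul_tmul']
  refine h.jacobiator_eq_zero_of_pure a (fun j => quadForm (0, j + k) (1, j) r s t)
    (fun j => quadForm' (0, j + k) (1, j) r s t)
    (fun j => FreeAlgebra.ι K (0, j + k) + s • 1) (fun j => FreeAlgebra.ι K (1, j) + t • 1)
    (fun j => ?_) (fun i j => ?_) (fun i j => ?_) (fun i j => ?_) (fun i j => ?_)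
    (fun j => ?_) (fun j => ?_) x y z
  · rw [map_smul, diagPow_tmul, quadForm, quadForm', map_add, map_add, shift_zpow_affineForm,
      map_mul, map_mul, shift_zpow_ι, shift_zpow_ι, zero_add, add_comm k]
    rfl
  · simp [quadForm, affineForm, h.isDoubleBracket.left, h.u_u, h.map_one_right, eR]
  · simp [quadForm', affineForm, h.isDoubleBracket.left, h.u_u, h.map_one_right, eL]
  · simp [quadForm', affineForm, h.isDoubleBracket.left, h.v_v, h.map_one_right, eR]
  · simp [quadForm, affineForm, h.isDoubleBracket.left, h.v_v, h.map_one_right, eL]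
  · simp only [quadForm, quadForm', affineForm, mul_add, add_mul, smul_mul_assoc,
      mul_smul_comm, mul_one, one_mul, mul_assoc, smul_add, smul_smul]
    module
  · simp only [quadForm, quadForm', affineForm, mul_add, add_mul, smul_mul_assoc,
      mul_smul_comm, mul_one, one_mul, mul_assoc, smul_add, smul_smul]
    module

end IsMonomialDoubleBracket

end Jacobi

/-! ### Translations and the five normal forms -/

section NormalForms

variable {K : Type*} [Field K]

theorem translation_ι (μ ν : K) (p : Fin 2 × ℤ) :
    translation μ ν (FreeAlgebra.ι K p) = FreeAlgebra.ι K p + (![μ, ν] p.1) • 1 := by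
  rw [translation, FreeAlgebra.lift_ι_apply, Algebra.algebraMap_eq_smul_one]

theorem diag_translation_neg (μ ν : K) (t : R2 K ⊗[K] R2 K) :
    diag (translation (-μ) (-ν)) (diag (translation μ ν) t) = t := by
  have h : (translation (-μ) (-ν)).comp (translation μ ν) = AlgHom.id K (R2 K) := by
    ext ⟨e, i⟩
    fin_cases e <;> simp [translation_ι]
  have h' : ∀ a, translation (-μ) (-ν) (translation μ ν a) = a := DFunLike.congr_fun h
  induction t using TensorProduct.induction_on with
  | zero => simp
  | add x y hx hy => simp only [map_add, hx, hy]
  | tmul x y => rw [diag_tmul, diag_tmul, h', h']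

theorem translation_affineForm (k : ℤ) (μ ν r s t : K) :
    translation μ ν (affineForm (0, k) (1, 0) r s t) =
      affineForm (0, k) (1, 0) (r + s * ν + t * μ) s t := by
  simp only [affineForm, map_add, map_smul, translation_ι, map_one]
  simp only [Matrix.cons_val_zero, Matrix.cons_val_one]
  module

theorem translation_quadForm (k : ℤ) (μ ν r s t : K) :
    translation μ ν (quadForm (0, k) (1, 0) r s t) =
      quadForm (0, k) (1, 0) (r + s * ν + t * μ + μ * ν) (s + μ) (t + ν) := by
  rw [quadForm, map_add, translation_affineForm, map_mul, translation_ι, translation_ι]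
  simp only [Matrix.cons_val_zero, Matrix.cons_val_one, quadForm, affineForm, add_mul, mul_add,
    smul_mul_assoc, mul_smul_comm, mul_one, one_mul]
  module

theorem translation_quadForm' (k : ℤ) (μ ν r s t : K) :
    translation μ ν (quadForm' (0, k) (1, 0) r s t) =
      quadForm' (0, k) (1, 0) (r + s * ν + t * μ + μ * ν) (s + μ) (t + ν) := by
  rw [quadForm', map_add, translation_affineForm, map_mul, translation_ι, translation_ι]
  simp only [Matrix.cons_val_zero, Matrix.cons_val_one, quadForm', affineForm, add_mul, mul_add,
    smul_mul_assoc, mul_smul_comm, mul_one, one_mul]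
  module

/-- `g = a w ⊗ w` with `w = s v + t u_k + r`. -/
def IsAffineSquare (k : ℤ) (g : R2 K ⊗[K] R2 K) (a r s t : K) : Prop :=
  g = a • (affineForm ((0 : Fin 2), k) (1, 0) r s t ⊗ₜ[K] affineForm (0, k) (1, 0) r s t)

/-- `g = a (v u_k + s v + t u_k + r) ⊗ (u_k v + s v + t u_k + r)`. -/
def IsQuadSquare (k : ℤ) (g : R2 K ⊗[K] R2 K) (a r s t : K) : Prop :=
  g = a • (quadForm ((0 : Fin 2), k) (1, 0) r s t ⊗ₜ[K] quadForm' (0, k) (1, 0) r s t)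

theorem IsAffineSquare.translation {k : ℤ} {g : R2 K ⊗[K] R2 K} {a r s t : K}
    (h : IsAffineSquare k g a r s t) (μ ν : K) :
    IsAffineSquare k (diag (translation μ ν) g) a (r + s * ν + t * μ) s t := by
  rw [IsAffineSquare, h, map_smul, diag_tmul, translation_affineForm]

theorem IsQuadSquare.translation {k : ℤ} {g : R2 K ⊗[K] R2 K} {a r s t : K}
    (h : IsQuadSquare k g a r s t) (μ ν : K) :
    IsQuadSquare k (diag (translation μ ν) g) a
      (r + s * ν + t * μ + μ * ν) (s + μ) (t + ν) := by
  rw [IsQuadSquare, h, map_smul, diag_tmul, translation_quadForm, translation_quadForm']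

/-- The union of the orbits under translations of each of the five normal forms. -/
def orbitForm (k : ℤ) (g : R2 K ⊗[K] R2 K) : Fin 5 → Prop :=
  ![ ∃ a r : K, IsAffineSquare k g a r 0 0,
     ∃ a r s : K, a ≠ 0 ∧ s ≠ 0 ∧ IsAffineSquare k g a r s 0,
     ∃ a r t : K, a ≠ 0 ∧ t ≠ 0 ∧ IsAffineSquare k g a r 0 t,
     ∃ a r s t : K, a ≠ 0 ∧ s ≠ 0 ∧ t ≠ 0 ∧ IsAffineSquare k g a r s t,
     ∃ a r s t : K, a ≠ 0 ∧ IsQuadSquare k g a r s t ]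

theorem orbitForm_translation {k : ℤ} {g : R2 K ⊗[K] R2 K} (i : Fin 5) (μ ν : K)
    (h : orbitForm k g i) : orbitForm k (diag (translation μ ν) g) i := by
  fin_cases i
  · obtain ⟨a, r, h⟩ := h
    exact ⟨a, _, h.translation μ ν⟩
  · obtain ⟨a, r, s, ha, hs, h⟩ := h
    exact ⟨a, _, s, ha, hs, h.translation μ ν⟩
  · obtain ⟨a, r, t, ha, ht, h⟩ := h
    exact ⟨a, _, t, ha, ht, h.translation μ ν⟩
  · obtain ⟨a, r, s, t, ha, hs, ht, h⟩ := h
    exact ⟨a, _, s, t, ha, hs, ht, h.translation μ ν⟩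
  · obtain ⟨a, r, s, t, ha, h⟩ := h
    exact ⟨a, _, _, _, ha, h.translation μ ν⟩

theorem orbitForm_of_normalForm {k : ℤ} {g : R2 K ⊗[K] R2 K} (i : Fin 5)
    (h : normalForm k g i) : orbitForm k g i := by
  fin_cases i
  · obtain ⟨a, rfl⟩ := h
    refine ⟨a, 1, ?_⟩
    simp [IsAffineSquare, affineForm]
  · obtain ⟨a, ha, rfl⟩ := h
    refine ⟨a, 0, 1, ha, one_ne_zero, ?_⟩
    simp [IsAffineSquare, affineForm, v]
  · obtain ⟨a, ha, rfl⟩ := h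
    refine ⟨a, 0, 1, ha, one_ne_zero, ?_⟩
    simp [IsAffineSquare, affineForm, u]
  · obtain ⟨a, b, ha, hb, rfl⟩ := h
    refine ⟨a, 0, 1, b / a, ha, one_ne_zero, div_ne_zero hb ha, ?_⟩
    have h1 : a * (b / a) = b := by field_simp
    have h2 : a * (b / a * (b / a)) = b ^ 2 / a := by field_simp
    simp only [IsAffineSquare, affineForm, u, v, one_smul, zero_smul, add_zero,
      TensorProduct.add_tmul, TensorProduct.tmul_add, ← TensorProduct.smul_tmul',
      TensorProduct.tmul_smul, smul_add, smul_smul, h1, h2]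
    abel
  · obtain ⟨a, b, ha, rfl⟩ := h
    refine ⟨a, b / a, 0, 0, ha, ?_⟩
    have h1 : a * (b / a) = b := by field_simp
    have h2 : a * (b / a * (b / a)) = b ^ 2 / a := by field_simp
    simp only [IsQuadSquare, quadForm, quadForm', affineForm, u, v, zero_smul, zero_add,
      TensorProduct.add_tmul, TensorProduct.tmul_add, ← TensorProduct.smul_tmul',
      TensorProduct.tmul_smul, smul_add, smul_smul, h1, h2]
    abel

theorem exists_normalForm_of_orbitForm {k : ℤ} {g : R2 K ⊗[K] R2 K} (i : Fin 5)
    (h : orbitForm k g i) : ∃ μ ν : K, normalForm k (diag (translation μ ν) g) i := by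
  fin_cases i
  · obtain ⟨a, r, h⟩ := h
    refine ⟨0, 0, a * (r * r), ?_⟩
    rw [h.translation 0 0]
    simp [affineForm, ← TensorProduct.smul_tmul', smul_smul]
  · obtain ⟨a, r, s, ha, hs, h⟩ := h
    -- Translating `v` by `-r / s` removes the constant term of `s v + r`.
    refine ⟨0, -r / s, a * (s * s), mul_ne_zero ha (mul_ne_zero hs hs), ?_⟩
    have hr : r + s * (-r / s) + 0 * 0 = 0 := by field_simp; ring
    rw [h.translation 0 (-r / s), hr]
    simp [affineForm, ← TensorProduct.smul_tmul', smul_smul, v]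
  · obtain ⟨a, r, t, ha, ht, h⟩ := h
    refine ⟨-r / t, 0, a * (t * t), mul_ne_zero ha (mul_ne_zero ht ht), ?_⟩
    have hr : r + 0 * 0 + t * (-r / t) = 0 := by field_simp; ring
    rw [h.translation (-r / t) 0, hr]
    simp [affineForm, ← TensorProduct.smul_tmul', smul_smul, u]
  · obtain ⟨a, r, s, t, ha, hs, ht, h⟩ := h
    refine ⟨0, -r / s, a * (s * s), a * (s * t), mul_ne_zero ha (mul_ne_zero hs hs),
      mul_ne_zero ha (mul_ne_zero hs ht), ?_⟩
    have hr : r + s * (-r / s) + t * 0 = 0 := by field_simp; ring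
    have h2 : (a * (s * t)) ^ 2 / (a * (s * s)) = a * (t * t) := by field_simp
    rw [h.translation 0 (-r / s), hr, h2]
    simp only [affineForm, u, v, zero_smul, add_zero,
      TensorProduct.add_tmul, TensorProduct.tmul_add, ← TensorProduct.smul_tmul',
      TensorProduct.tmul_smul, smul_add, smul_smul, mul_comm t s]
    abel
  · obtain ⟨a, r, s, t, ha, h⟩ := h
    -- Since `v u + s v + t u + r = (v + t)(u + s) + (r - s t)`, this translation removes the linear
    -- terms and leaves the constant `r - s t = b / a`.
    refine ⟨-s, -t, a, a * (r - s * t), ha, ?_⟩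
    have hr : r + s * -t + t * -s + -s * -t = r - s * t := by ring
    have h2 : (a * (r - s * t)) ^ 2 / a = a * ((r - s * t) * (r - s * t)) := by field_simp
    rw [h.translation (-s) (-t), hr, h2, add_neg_cancel, add_neg_cancel]
    simp only [quadForm, quadForm', affineForm, u, v, zero_smul, zero_add,
      TensorProduct.add_tmul, TensorProduct.tmul_add, ← TensorProduct.smul_tmul',
      TensorProduct.tmul_smul, smul_add, smul_smul]
    abel

theorem exists_normalForm_iff {k : ℤ} {g : R2 K ⊗[K] R2 K} (i : Fin 5) :
    (∃ μ ν : K, normalForm k (diag (translation μ ν) g) i) ↔ orbitForm k g i := by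
  refine ⟨fun ⟨μ, ν, h⟩ => ?_, exists_normalForm_of_orbitForm i⟩
  rw [← diag_translation_neg μ ν g]
  exact orbitForm_translation i _ _ (orbitForm_of_normalForm i h)

/-- The coefficient of `vu_k ⊗ u_k v` detects the quadratic form. Those of `v ⊗ v` and `u_k ⊗ u_k`
distinguish the affine ones; they carry no information for the quadratic form, where they are `a s²`
and `a t²` with `s, t` arbitrary. -/
theorem orbitForm_index {k : ℤ} {g : R2 K ⊗[K] R2 K} (i : Fin 5) (h : orbitForm k g i) :
    (wcoef₂ [(1, 0), (0, k)] [(0, k), (1, 0)] g ≠ 0 ↔ i = 4) ∧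
    (i ≠ 4 → ((wcoef₂ [(1, 0)] [(1, 0)] g ≠ 0 ↔ i = 1 ∨ i = 3) ∧
      (wcoef₂ [(0, k)] [(0, k)] g ≠ 0 ↔ i = 2 ∨ i = 3))) := by
  fin_cases i
  · obtain ⟨a, r, h⟩ := h
    rw [h]
    simp [wcoef₂_tmul, wcoef_affineForm]
  · obtain ⟨a, r, s, ha, hs, h⟩ := h
    rw [h]
    simp [wcoef₂_tmul, wcoef_affineForm, ha, hs]
  · obtain ⟨a, r, t, ha, ht, h⟩ := h
    rw [h]
    simp [wcoef₂_tmul, wcoef_affineForm, ha, ht]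
  · obtain ⟨a, r, s, t, ha, hs, ht, h⟩ := h
    rw [h]
    simp [wcoef₂_tmul, wcoef_affineForm, ha, hs, ht]
  · obtain ⟨a, r, s, t, ha, h⟩ := h
    rw [h]
    simp [wcoef₂_tmul, wcoef_quadForm, wcoef_quadForm', ha]

theorem orbitForm_unique {k : ℤ} {g : R2 K ⊗[K] R2 K} {i j : Fin 5} (hi : orbitForm k g i)
    (hj : orbitForm k g j) : i = j := by
  obtain ⟨h1, h2⟩ := orbitForm_index i hi
  obtain ⟨h3, h4⟩ := orbitForm_index j hj
  have e1 : i = 4 ↔ j = 4 := h1.symm.trans h3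
  by_cases hi4 : i = 4
  · rw [hi4, e1.1 hi4]
  · have hj4 : j ≠ 4 := fun h => hi4 (e1.2 h)
    obtain ⟨h5, h6⟩ := h2 hi4
    obtain ⟨h7, h8⟩ := h4 hj4
    have e2 := h5.symm.trans h7
    have e3 := h6.symm.trans h8
    clear h1 h2 h3 h4 h5 h6 h7 h8 hi hj e1
    revert i j
    decide

theorem existsUnique_normalForm_iff {k : ℤ} {g : R2 K ⊗[K] R2 K} :
    (∃! i : Fin 5, ∃ μ ν : K, normalForm k (diag (translation μ ν) g) i) ↔
      (∃ a r s t, IsAffineSquare k g a r s t) ∨ ∃ a r s t, a ≠ 0 ∧ IsQuadSquare k g a r s t := by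
  simp only [exists_normalForm_iff]
  constructor
  · rintro ⟨i, h, -⟩
    fin_cases i
    · obtain ⟨a, r, h⟩ := h
      exact Or.inl ⟨_, _, _, _, h⟩
    · obtain ⟨a, r, s, -, -, h⟩ := h
      exact Or.inl ⟨_, _, _, _, h⟩
    · obtain ⟨a, r, t, -, -, h⟩ := h
      exact Or.inl ⟨_, _, _, _, h⟩
    · obtain ⟨a, r, s, t, -, -, -, h⟩ := h
      exact Or.inl ⟨_, _, _, _, h⟩
    · exact Or.inr h
  · suffices hex : _ → ∃ i, orbitForm k g i from fun h =>
      (hex h).elim fun i hi => ⟨i, hi, fun j hj => orbitForm_unique hj hi⟩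
    rintro (⟨a, r, s, t, h⟩ | h)
    -- The zero element is covered only by the first form, the one that allows `a = 0`.
    · by_cases ha : a = 0
      · exact ⟨0, a, r, by rw [IsAffineSquare, h, ha, zero_smul, zero_smul]⟩
      by_cases hs : s = 0 <;> by_cases ht : t = 0
      · exact ⟨0, a, r, by rwa [hs, ht] at h⟩
      · exact ⟨2, a, r, t, ha, ht, by rwa [hs] at h⟩
      · exact ⟨1, a, r, s, ha, hs, by rwa [ht] at h⟩
      · exact ⟨3, a, r, s, t, ha, hs, ht, h⟩
    · exact ⟨4, h⟩

theorem IsMonomialBracket.isDoubleMPVA_iff_square {k : ℤ} {g : R2 K ⊗[K] R2 K}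
    {B : LambdaMap K (R2 K)} (hB : IsMonomialBracket k g B) :
    IsDoubleMPVA (shift K) B ↔
      (∃ a r s t, IsAffineSquare k g a r s t) ∨
        ∃ a r s t, a ≠ 0 ∧ IsQuadSquare k g a r s t := by
  rw [hB.isDoubleMPVA_iff]
  refine ⟨hB.coeff_zero.forms_of_jacobiator, ?_⟩
  rintro (⟨a, r, s, t, h⟩ | ⟨a, r, s, t, -, h⟩)
  · have hP := hB.coeff_zero
    rw [h] at hP
    exact hP.jacobiator_affineForm
  · have hP := hB.coeff_zero
    rw [h] at hP
    exact hP.jacobiator_quadForm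

end NormalForms

end DoubleMPVA

end

open DoubleMPVA in
theorem theorem4p9 (K : Type*) [Field K] [CharZero K] (k : ℤ) (g : R2 K ⊗[K] R2 K) :
    (∃! B : LambdaMap K (R2 K), IsMonomialBracket k g B) ∧
    ∀ B : LambdaMap K (R2 K), IsMonomialBracket k g B →
      (IsDoubleMPVA (shift K) B ↔
        ∃! i : Fin 5, ∃ μ ν : K, normalForm k (diag (translation μ ν) g) i) := by
  refine ⟨existsUnique_isMonomialBracket k g, fun B hB => ?_⟩
  rw [hB.isDoubleMPVA_iff_square, existsUnique_normalForm_iff]
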